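/- Fix $\lambda>0$ and $p\in(0,1)$. Consider a Poisson process of rate $\lambda$ on $\mathbb{R}_+=[0,\infty)$ in which each point is, independently, blue with probability $p$ and red with probability $1-p$. Let $$\rho(x,y)=2^{-\sup\{k\in\mathbb{Z}:\ \lfloor 2^k x\rfloor=\lfloor 2^k y\rfloor\}}\qquad(x,y\ge 0,\ \text{with } \rho(x,x)=0),$$ and for points $x,y$ of the process let $\ell(x,y)=\rho(x,y)$, except that $\ell(x,y)=\infty$ if $x=y$ or if $x$ and $y$ are both blue. A matching is an involution $M$ of the set of points such that $\ell(x,M(x))<\infty$ whenever $M(x)\neq x$; the point $x$ is unmatched if $M(x)=x$. The matching $M$ is stable if $\ell(x,y)\ge\min\{\ell(x,M(x)),\ell(y,M(y))\}$ for all points $x,y$. Then, with probability 1, there are infinitely many stable matchings, and each of them has infinitely many unmatched blue points. In fact, there exists $c=c(\lambda,p)>0$ such that, with probability 1, for all sufficiently large $R$ (how large may depend on the realization but not on the matching), every stable matching has at least $cR$ unmatched blue points in $[0,R]$. -/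

import Mathlib

open MeasureTheory ProbabilityTheory Set Filter
open scoped ENNReal NNReal

noncomputable section

namespace HierMatching

/-- The hierarchical (dyadic) ultrametric on `[0, ∞)`:
`ρ(x, y) = 2 ^ (- sup {k ∈ ℤ : ⌊2 ^ k x⌋ = ⌊2 ^ k y⌋})`. For `x = y` the supremum is `+∞` and the
value is `0`; for distinct `x, y ≥ 0` the set of integers is nonempty and bounded above. -/
def rho (x y : ℝ) : ℝ :=
  open Classical in
  if x = y then 0
  else (2 : ℝ) ^ (-sSup {k : ℤ | ⌊(2 : ℝ) ^ k * x⌋ = ⌊(2 : ℝ) ^ k * y⌋})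

/-- A matching of the graph on `V` whose edges are the pairs of finite weight `ℓ`: an involution
`M` (a point with `M x = x` is unmatched) that matches points only along edges. -/
def IsMatching {V : Type*} (ℓ : V → V → ℝ≥0∞) (M : V → V) : Prop :=
  (∀ x, M (M x) = x) ∧ ∀ x, M x ≠ x → ℓ x (M x) < ∞

/-- Stable matchings for a weight function `ℓ` with `ℓ x x = ∞`: with `d_M(x) = ℓ(x, M x)`, one has
`ℓ(x, y) ≥ min(d_M(x), d_M(y))` for all `x, y`. -/
def IsStableMatching {V : Type*} (ℓ : V → V → ℝ≥0∞) (M : V → V) : Prop :=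
  IsMatching ℓ M ∧ ∀ x y, min (ℓ x (M x)) (ℓ y (M y)) ≤ ℓ x y

/-- The weights of the asymmetric two-type model for points with positions `x i` and colours
`blue i` (`true` is blue, `false` is red): the distance `ρ`, except that two blue points
are not allowed to be matched. -/
def weight {V : Type*} (x : V → ℝ) (blue : V → Bool) (i j : V) : ℝ≥0∞ :=
  open Classical in
  if i = j ∨ (blue i = true ∧ blue j = true) then ∞ else ENNReal.ofReal (rho (x i) (x j))

/-- The set of stable matchings of the asymmetric two-type model in the hierarchical metric. -/
def stableMatchings {V : Type*} (x : V → ℝ) (blue : V → Bool) : Set (V → V) :=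
  {M | IsStableMatching (weight x blue) M}

/-- The blue points left unmatched by `M`. -/
def unmatchedBlue {V : Type*} (blue : V → Bool) (M : V → V) : Set V :=
  {i | blue i = true ∧ M i = i}

/-- `X 0, X 1, …` is an enumeration (without repetition, in any order) of the points of a
homogeneous Poisson process of rate `lam` on `[0, ∞)`: the number of points in a Borel set
`A ⊆ [0, ∞)` of finite Lebesgue measure `|A|` has the Poisson distribution with mean `lam * |A|`,
and the numbers of points in disjoint such sets are independent. -/
structure IsPoissonProcess {Ω : Type*} [MeasurableSpace Ω] (P : Measure Ω) (lam : ℝ)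
    (X : ℕ → Ω → ℝ) : Prop where
  measurable : ∀ n, Measurable (X n)
  nonneg : ∀ᵐ ω ∂P, ∀ n, 0 ≤ X n ω
  injective : ∀ᵐ ω ∂P, Function.Injective fun n => X n ω
  law_count : ∀ A : Set ℝ, MeasurableSet A → A ⊆ Ici 0 → volume A ≠ ∞ →
    HasLaw (fun ω => {n | X n ω ∈ A}.encard)
      ((poissonMeasure (lam.toNNReal * (volume A).toNNReal)).map ((↑) : ℕ → ℕ∞)) P
  indep_count : ∀ (m : ℕ) (A : Fin m → Set ℝ),
    (∀ i, MeasurableSet (A i) ∧ A i ⊆ Ici 0 ∧ volume (A i) ≠ ∞) →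
    Pairwise (fun i j => Disjoint (A i) (A j)) →
    iIndepFun (fun i ω => {n | X n ω ∈ A i}.encard) P

/-- `X` enumerates a Poisson process of rate `lam` on `[0, ∞)` and, independently of the positions
and of each other, each point `X n` is blue (`blue n = true`) with probability `p` and
red otherwise. -/
structure IsColouredPoissonProcess {Ω : Type*} [MeasurableSpace Ω] (P : Measure Ω) (lam p : ℝ)
    (X : ℕ → Ω → ℝ) (blue : ℕ → Ω → Bool) : Prop where
  poisson : IsPoissonProcess P lam X
  measurable_blue : ∀ n, Measurable (blue n)
  prob_blue : ∀ n, P {ω | blue n ω = true} = ENNReal.ofReal p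
  indep_blue : iIndepFun blue P
  indep_points_blue : IndepFun (fun ω n => X n ω) (fun ω n => blue n ω) P

end HierMatching

end

/-! Fix a stable matching and consider the points of a dyadic interval that are not matched inside
it. Any two of them are at distance at most the length of the interval, while each has a farther
partner or none. Stability therefore forces both to be blue, so the leftover is a single red point
or a set of blue points. It is summarised by the state, blue minus red, an integer at least -1.
States of two halves add up in the parent, except that two lone reds match each other, so -1 and -1
give 0 (`state_add_one`). On a mesh so fine that cells hold at most one point, states can be read
off the configuration. Hence they do not depend on the matching, and the states of unit intervals
are i.i.d. (`IsColouredPoissonProcess.exists_state_process`).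

Let b be the mean positive part of the state at some level, and q, x, β the probabilities that it is
-1, is 1, is at least 1. One merge turns b into 2b - 2qβ. Parity is additive under merging, so after
one merge the state is odd with probability at most 1/2, whence q + x ≤ 1/2. This makes b grow by a
fixed amount per level (`growth_arith`), and at some level H the mean state is at least 1. Since
merging is superadditive, the strong law makes the state of [0, 2^N) at least linear in 2^N and the
state of [2^n, 2^(n+1)) positive for all large n. A blue point left over in [0, 2^N) could only be
matched to a red point left over in one of those siblings, and there is none.

For infinitely many matchings, two blue points that are equidistant from all others can be
exchanged. Almost surely infinitely many disjoint places have such a pair competing for a red point,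
and each exchange gives a different stable matching. -/

namespace HierMatching

/-! ### Dyadic cells, the ultrametric and the weights -/

/-- The index of the dyadic interval of length `2 ^ n` that contains `x`. -/
noncomputable def cell (n : ℤ) (x : ℝ) : ℤ := ⌊(2 : ℝ) ^ (-n) * x⌋

theorem cell_add_one (n : ℤ) (x : ℝ) : cell (n + 1) x = cell n x / 2 := by
  unfold cell
  have h := Int.floor_div_natCast ((2 : ℝ) ^ (-n) * x) 2
  rw [show (2 : ℝ) ^ (-(n + 1)) * x = (2 : ℝ) ^ (-n) * x / (2 : ℕ) by
    rw [neg_add, zpow_add₀ (by norm_num)]; norm_num; ring]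
  exact_mod_cast h

theorem cell_nonneg (n : ℤ) {x : ℝ} (hx : 0 ≤ x) : 0 ≤ cell n x :=
  Int.floor_nonneg.2 (by positivity)

theorem cell_eq_mono {n m : ℤ} (h : n ≤ m) {x y : ℝ} (hxy : cell n x = cell n y) :
    cell m x = cell m y := by
  induction m, h using Int.leInduction with
  | base => exact hxy
  | succ m _ ih => rw [cell_add_one, cell_add_one, ih]

theorem exists_cell_eq_zero {x : ℝ} (hx : 0 ≤ x) (N : ℤ) : ∃ n : ℕ, cell (N + n) x = 0 := by
  obtain ⟨n, hn⟩ := pow_unbounded_of_one_lt ((2 : ℝ) ^ (-N) * x) one_lt_two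
  refine ⟨n, Int.floor_eq_zero_iff.2 ⟨by positivity, ?_⟩⟩
  rw [neg_add, zpow_add₀ (by norm_num), zpow_neg _ (n : ℤ), zpow_natCast, mul_right_comm,
    ← div_eq_mul_inv, div_lt_one (by positivity)]
  exact hn

theorem cell_eq_iff_mem_Ico (n : ℤ) (x : ℝ) (j : ℤ) :
    cell n x = j ↔ x ∈ Ico (j * (2 : ℝ) ^ n) ((j + 1) * 2 ^ n) := by
  have h : (0 : ℝ) < 2 ^ n := by positivity
  rw [cell, Int.floor_eq_iff, zpow_neg, mem_Ico, inv_mul_eq_div, le_div_iff₀ h, div_lt_iff₀ h]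

theorem exists_cell_ne {x y : ℝ} (hxy : x ≠ y) : ∃ n : ℤ, cell n x ≠ cell n y := by
  have hd : 0 < |x - y| := abs_pos.2 (sub_ne_zero.2 hxy)
  obtain ⟨n, hn⟩ := pow_unbounded_of_one_lt (|x - y|⁻¹) one_lt_two
  refine ⟨-n, fun h => ?_⟩
  have h1 := Int.abs_sub_lt_one_of_floor_eq_floor h
  rw [neg_neg, zpow_natCast, ← mul_sub, abs_mul, abs_of_pos (by positivity)] at h1
  rw [inv_lt_iff_one_lt_mul₀ hd] at hn
  linarith

/-- The supremum defining `rho` is attained: distinct points are separated at fine levels, so the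
set is bounded, and nonnegative points share a coarse cell, so it is nonempty. This reduces
comparisons of `rho` with powers of two to cells. -/
theorem rho_le_iff {x y : ℝ} (hx : 0 ≤ x) (hy : 0 ≤ y) (n : ℤ) :
    rho x y ≤ 2 ^ n ↔ cell n x = cell n y := by
  unfold rho
  split_ifs with hxy
  · simp only [hxy, iff_true]; positivity
  set K : Set ℤ := {k : ℤ | ⌊(2 : ℝ) ^ k * x⌋ = ⌊(2 : ℝ) ^ k * y⌋} with hK
  have hmem : ∀ k, k ∈ K ↔ cell (-k) x = cell (-k) y := fun k => by simp [hK, cell]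
  obtain ⟨N, hN⟩ := exists_cell_ne hxy
  have hbdd : BddAbove K := ⟨-N, fun k hk => by
    by_contra hlt
    exact hN (cell_eq_mono (by omega) ((hmem k).1 hk))⟩
  have hne : K.Nonempty := by
    obtain ⟨a, ha⟩ := exists_cell_eq_zero hx 0
    obtain ⟨b, hb⟩ := exists_cell_eq_zero hy 0
    refine ⟨-(max a b : ℕ), (hmem _).2 ?_⟩
    rw [neg_neg]
    have h0 : ∀ n : ℤ, cell n 0 = 0 := fun n => by simp [cell]
    have ha' := cell_eq_mono (show (0 : ℤ) + a ≤ (max a b : ℕ) by omega) (ha.trans (h0 _).symm)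
    have hb' := cell_eq_mono (show (0 : ℤ) + b ≤ (max a b : ℕ) by omega) (hb.trans (h0 _).symm)
    rw [ha', hb']
  rw [zpow_le_zpow_iff_right₀ one_lt_two]
  constructor
  · intro h
    exact cell_eq_mono h (by simpa using (hmem _).1 (Int.csSup_mem hne hbdd))
  · intro h
    have := le_csSup hbdd ((hmem (-n)).2 (by simpa using h))
    omega

theorem rho_comm (x y : ℝ) : rho x y = rho y x := by
  unfold rho
  simp only [eq_comm (a := x) (b := y), eq_comm (a := ⌊_ * x⌋)]

theorem weight_comm {V : Type*} (x : V → ℝ) (blue : V → Bool) (i j : V) :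
    weight x blue i j = weight x blue j i := by
  unfold weight
  rw [rho_comm]
  split_ifs <;> first | rfl | tauto

theorem weight_self {V : Type*} (x : V → ℝ) (blue : V → Bool) (i : V) :
    weight x blue i i = ∞ := by
  simp [weight]

theorem weight_lt_top_iff {V : Type*} (x : V → ℝ) (blue : V → Bool) (i j : V) :
    weight x blue i j < ∞ ↔ i ≠ j ∧ ¬(blue i = true ∧ blue j = true) := by
  unfold weight
  split_ifs with h
  · simp only [lt_self_iff_false, false_iff]; tauto
  · simp only [ENNReal.ofReal_lt_top, true_iff]; tauto

theorem weight_le_iff {V : Type*} {x : V → ℝ} (hx : ∀ i, 0 ≤ x i) (blue : V → Bool) (i j : V)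
    (n : ℤ) : weight x blue i j ≤ ENNReal.ofReal (2 ^ n) ↔
      weight x blue i j < ∞ ∧ cell n (x i) = cell n (x j) := by
  rw [← rho_le_iff (hx i) (hx j)]
  by_cases h : weight x blue i j < ∞
  · have h' := (weight_lt_top_iff x blue i j).1 h
    have : weight x blue i j = ENNReal.ofReal (rho (x i) (x j)) := by
      unfold weight; rw [if_neg (by tauto)]
    simp only [h, true_and]
    rw [this, ENNReal.ofReal_le_ofReal_iff (by positivity)]
  · simp only [h, false_and, iff_false, not_le]
    rw [not_lt, top_le_iff] at h
    rw [h]; exact ENNReal.ofReal_lt_top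

/-! ### Existence of a stable matching by the greedy rule -/

/-- A symmetric weight function under which every edge lies in a finite vertex set that is closed
under edges of at most its weight has a stable matching. -/
theorem exists_isStableMatching {V : Type*} [Countable V] (ℓ : V → V → ℝ≥0∞)
    (hcomm : ∀ i j, ℓ i j = ℓ j i)
    (hfin : ∀ i j, ℓ i j < ∞ → ∃ F : Set V, F.Finite ∧ i ∈ F ∧ j ∈ F ∧
      ∀ a ∈ F, ∀ b, ℓ a b ≤ ℓ i j → b ∈ F) :
    ∃ M, IsStableMatching ℓ M := by
  classical
  let w : Sym2 V → ℝ≥0∞ := Sym2.lift ⟨ℓ, hcomm⟩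
  have hw : ∀ i j, w s(i, j) = ℓ i j := fun i j => rfl
  obtain ⟨t, ht⟩ := exists_injective_nat (Sym2 V)
  -- Ties between weights are broken by an injection into ℕ, so that edges are strictly ordered.
  let key : Sym2 V → ℝ≥0∞ ×ₗ ℕ := fun e => toLex (w e, t e)
  have hkey : Function.Injective key := fun e e' h => ht (congrArg (fun a => (ofLex a).2) h)
  have hkey_le : ∀ {e e'}, key e' < key e → w e' ≤ w e := fun h => by
    rcases Prod.Lex.toLex_lt_toLex.1 h with h | h
    · exact h.le
    · exact h.1.le
  let R : Sym2 V → Sym2 V → Prop := fun e' e => w e < ∞ ∧ key e' < key e ∧ ∃ i, i ∈ e ∧ i ∈ e'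
  -- Predecessors of a finite edge stay among the finitely many edges inside the closed set `F`; an
  -- infinite edge has no predecessors.
  have hwf : WellFounded R := by
    refine ⟨fun e => ?_⟩
    by_cases he : w e < ∞
    swap
    · exact ⟨_, fun e' h => absurd h.1 he⟩
    induction e using Sym2.ind with
    | _ i j =>
    obtain ⟨F, hF, hi, hj, hcl⟩ := hfin i j he
    have hG : ((fun q : V × V => s(q.1, q.2)) '' (F ×ˢ F)).Finite := (hF.prod hF).image _
    have hwfo : ({e' ∈ (fun q : V × V => s(q.1, q.2)) '' (F ×ˢ F) | w e' ≤ ℓ i j}).WellFoundedOn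
        (fun a b => key a < key b) := by
      have : IsStrictOrder (Sym2 V) (fun a b => key a < key b) :=
        { irrefl := fun a => lt_irrefl _, trans := fun a b c => lt_trans }
      exact (hG.subset (sep_subset _ _)).wellFoundedOn
    refine hwfo.induction (P := Acc R) ⟨⟨(i, j), ⟨hi, hj⟩, rfl⟩, le_rfl⟩ ?_
    rintro _ ⟨⟨⟨a, b⟩, ⟨ha, hb⟩, rfl⟩, hab⟩ ih
    refine ⟨_, fun e' h => ih e' ?_ h.2.1⟩
    have hle : w e' ≤ ℓ i j := (hkey_le h.2.1).trans hab
    refine ⟨?_, hle⟩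
    obtain ⟨c, hc, hc'⟩ := h.2.2
    obtain ⟨d, rfl⟩ := Sym2.mem_iff_exists.1 hc'
    have hcF : c ∈ F := by
      rcases Sym2.mem_iff.1 hc with rfl | rfl
      · exact ha
      · exact hb
    exact ⟨(c, d), ⟨hcF, hcl c hcF d hle⟩, rfl⟩
  -- Greedy rule: an edge is selected unless a smaller edge sharing a vertex has been selected.
  let E : Sym2 V → Prop := hwf.fix (fun e ih => w e < ∞ ∧ ∀ e' (h : R e' e), ¬ ih e' h)
  have hE : ∀ e, E e ↔ w e < ∞ ∧ ∀ e', R e' e → ¬ E e' := fun e => by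
    simp only [E]
    rw [hwf.fix_eq]
  have huniq : ∀ i j k, E s(i, j) → E s(i, k) → j = k := fun i j k hj hk => by
    rcases lt_trichotomy (key s(i, j)) (key s(i, k)) with h | h | h
    · exact absurd hj (((hE _).1 hk).2 _ ⟨((hE _).1 hk).1, h, i, by simp, by simp⟩)
    · exact Sym2.congr_right.1 (hkey h)
    · exact absurd hk (((hE _).1 hj).2 _ ⟨((hE _).1 hj).1, h, i, by simp, by simp⟩)
  let M : V → V := fun i => if h : ∃ j, E s(i, j) then h.choose else i
  have hM : ∀ i j, E s(i, j) → M i = j := fun i j h => by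
    have h' : ∃ j, E s(i, j) := ⟨j, h⟩
    simp only [M, dif_pos h']
    exact huniq _ _ _ h'.choose_spec h
  have hM' : ∀ i, E s(i, M i) ∨ M i = i := fun i => by
    by_cases h : ∃ j, E s(i, j)
    · left
      simp only [M, dif_pos h]
      exact h.choose_spec
    · right; simp only [M, dif_neg h]
  refine ⟨M, ⟨fun i => ?_, fun i hi => ?_⟩, fun i j => ?_⟩
  · rcases hM' i with h | h
    · exact hM _ _ (by rwa [Sym2.eq_swap])
    · rw [h, h]
  · exact ((hE _).1 ((hM' i).resolve_right hi)).1
  · rcases eq_or_ne (ℓ i j) ∞ with h | h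
    · rw [h]; exact le_top
    by_cases hij : E s(i, j)
    · rw [hM _ _ hij]; exact min_le_left _ _
    rw [hE] at hij
    push Not at hij
    -- The selected edge that excluded this one gives an endpoint a partner at no greater weight.
    obtain ⟨e', he', hEe'⟩ := hij h.lt_top
    obtain ⟨a, ha, ha'⟩ := he'.2.2
    obtain ⟨b, rfl⟩ := Sym2.mem_iff_exists.1 ha'
    have hle : ℓ a (M a) ≤ ℓ i j := by rw [hM _ _ hEe']; exact hkey_le he'.2.1
    rcases Sym2.mem_iff.1 ha with rfl | rfl
    · exact (min_le_left _ _).trans hle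
    · exact (min_le_right _ _).trans hle

/-- Points in `[0, ∞)` that are locally finite have a stable matching. -/
theorem exists_mem_stableMatchings {V : Type*} [Countable V] {x : V → ℝ} (hx : ∀ i, 0 ≤ x i)
    (hfin : ∀ n k, {i | cell n (x i) = k}.Finite) (blue : V → Bool) :
    (stableMatchings x blue).Nonempty := by
  refine exists_isStableMatching _ (weight_comm x blue) fun i j hij => ?_
  obtain ⟨m, hm⟩ := exists_cell_eq_zero (hx i) 0
  obtain ⟨n, hn⟩ := exists_cell_eq_zero (hx j) ((0 : ℤ) + m)
  have h0 : ∀ n : ℤ, cell n 0 = 0 := fun n => by simp [cell]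
  have hi : cell (0 + m + n) (x i) = 0 := by
    exact (cell_eq_mono (show (0 : ℤ) + m ≤ 0 + m + n by omega) (hm.trans (h0 _).symm)).trans (h0 _)
  refine ⟨{a | cell (0 + m + n) (x a) = 0}, hfin _ _, hi, hn, fun a ha b hab => ?_⟩
  have h1 := (weight_le_iff hx blue i j (0 + m + n)).2 ⟨hij, hi.trans hn.symm⟩
  exact ((weight_le_iff hx blue a b _).1 (hab.trans h1)).2.symm.trans ha

/-! ### Leftover points and the recursion for states -/

theorem cell_add_nat (n : ℤ) (m : ℕ) (x : ℝ) : cell (n + m) x = cell n x / 2 ^ m := by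
  induction m with
  | zero => simp
  | succ m ih =>
    rw [Nat.cast_succ, ← add_assoc, cell_add_one, ih, Int.ediv_ediv_of_nonneg (by positivity),
      pow_succ]

/-- The points of the `k`-th dyadic interval at level `n` that `M` does not match inside it. -/
def leftover {V : Type*} (x : V → ℝ) (M : V → V) (n k : ℤ) : Set V :=
  {i | cell n (x i) = k ∧ (M i = i ∨ cell n (x (M i)) ≠ k)}

/-- Blue counts `1` and red counts `-1`. -/
def sgn (b : Bool) : ℤ := if b then 1 else -1

/-- The number of blue minus the number of red points of a dyadic interval that are left over. -/
noncomputable def state {V : Type*} (x : V → ℝ) (blue : V → Bool) (M : V → V) (n k : ℤ) : ℤ :=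
  ∑ᶠ i ∈ leftover x M n k, sgn (blue i)

/-- The state of a dyadic interval in terms of those of its two halves. -/
def join (a b : ℤ) : ℤ := a + b + if a = -1 ∧ b = -1 then 2 else 0

/-- From the states at one level to those at the next. -/
def merge (s : ℕ → ℤ) (k : ℕ) : ℤ := join (s (2 * k)) (s (2 * k + 1))

open Classical in
/-- `0`, `1`, `-1` for a dyadic interval with no point, a single blue or a single red point, and `2`
for one with several points. -/
noncomputable def label {V : Type*} (x : V → ℝ) (blue : V → Bool) (n k : ℤ) : ℤ :=
  if ∃ i, cell n (x i) = k ∧ blue i = true ∧ ∀ j, cell n (x j) = k → j = i then 1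
  else if ∃ i, cell n (x i) = k ∧ blue i = false ∧ ∀ j, cell n (x j) = k → j = i then -1
  else if ∀ i, cell n (x i) ≠ k then 0 else 2

section Stable

variable {V : Type*} {x : V → ℝ} {blue : V → Bool} {M : V → V}

theorem lt_weight_of_mem_leftover (hx : ∀ i, 0 ≤ x i) {n k : ℤ} {i : V}
    (hi : i ∈ leftover x M n k) : ENNReal.ofReal (2 ^ n) < weight x blue i (M i) := by
  rw [← not_le, weight_le_iff hx, weight_lt_top_iff]
  rintro ⟨⟨h1, -⟩, h2⟩
  rcases hi.2 with h | h
  · exact h1 h.symm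
  · exact h (h2.symm.trans hi.1)

/-- Otherwise the two points form an edge of weight at most `2 ^ n` while both have matching weight
above it, which contradicts stability. -/
theorem blue_of_mem_leftover (hx : ∀ i, 0 ≤ x i) (hM : M ∈ stableMatchings x blue) {n k : ℤ}
    {i j : V} (hi : i ∈ leftover x M n k) (hj : j ∈ leftover x M n k) (hij : i ≠ j) :
    blue i = true ∧ blue j = true := by
  by_contra hb
  have h1 := (weight_le_iff hx blue i j n).2
    ⟨(weight_lt_top_iff x blue i j).2 ⟨hij, hb⟩, hi.1.trans hj.1.symm⟩
  exact (lt_min (lt_weight_of_mem_leftover hx hi) (lt_weight_of_mem_leftover hx hj)).not_ge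
    ((hM.2 i j).trans h1)

theorem leftover_finite (hfin : ∀ n k, {i | cell n (x i) = k}.Finite) (M : V → V) (n k : ℤ) :
    (leftover x M n k).Finite :=
  (hfin n k).subset fun _ h => h.1

theorem state_cases (hx : ∀ i, 0 ≤ x i) (hfin : ∀ n k, {i | cell n (x i) = k}.Finite)
    (hM : M ∈ stableMatchings x blue) (n k : ℤ) :
    (∃ r, blue r = false ∧ leftover x M n k = {r} ∧ state x blue M n k = -1) ∨
    ((∀ i ∈ leftover x M n k, blue i = true) ∧
      state x blue M n k = (leftover x M n k).ncard) := by
  by_cases h : ∃ r ∈ leftover x M n k, blue r = false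
  · obtain ⟨r, hr, hrb⟩ := h
    have hL : leftover x M n k = {r} := by
      refine eq_singleton_iff_unique_mem.2 ⟨hr, fun i hi => ?_⟩
      by_contra hne
      simp [(blue_of_mem_leftover hx hM hi hr hne).2] at hrb
    refine Or.inl ⟨r, hrb, hL, ?_⟩
    rw [state, hL, finsum_mem_singleton, hrb]; rfl
  · push Not at h
    have h' : ∀ i ∈ leftover x M n k, blue i = true := fun i hi => by simpa using h i hi
    refine Or.inr ⟨h', ?_⟩
    have h1 : ∀ i ∈ leftover x M n k, sgn (blue i) = 1 := fun i hi => by rw [h' i hi]; rfl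
    rw [state, finsum_mem_congr rfl h1,
      finsum_mem_eq_finite_toFinset_sum _ (leftover_finite hfin M n k),
      Set.ncard_eq_toFinset_card _ (leftover_finite hfin M n k)]
    simp

theorem neg_one_le_state (hx : ∀ i, 0 ≤ x i) (hfin : ∀ n k, {i | cell n (x i) = k}.Finite)
    (hM : M ∈ stableMatchings x blue) (n k : ℤ) :
    -1 ≤ state x blue M n k := by
  rcases state_cases hx hfin hM n k with ⟨r, -, -, h⟩ | ⟨-, h⟩ <;> omega

theorem mem_leftover_add_one (hM : M ∈ stableMatchings x blue) (n k : ℤ) (i : V) :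
    i ∈ leftover x M (n + 1) k ↔
      (i ∈ leftover x M n (2 * k) ∧ M i ∉ leftover x M n (2 * k + 1)) ∨
      (i ∈ leftover x M n (2 * k + 1) ∧ M i ∉ leftover x M n (2 * k)) := by
  simp only [leftover, mem_ofPred_eq, cell_add_one, hM.1.1 i]
  by_cases h : M i = i
  · simp only [h, true_or, and_true, ne_eq]; omega
  · simp only [h, Ne.symm h, false_or]; omega

/-- The parent loses exactly the pairs matched across its halves. A cross pair of one blue and one
red contributes 0 to the sum, so only a red-red pair changes it. -/
theorem state_add_one (hx : ∀ i, 0 ≤ x i) (hfin : ∀ n k, {i | cell n (x i) = k}.Finite)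
    (hM : M ∈ stableMatchings x blue) (n k : ℤ) :
    state x blue M (n + 1) k =
      join (state x blue M n (2 * k)) (state x blue M n (2 * k + 1)) := by
  set A := leftover x M n (2 * k) with hA
  set B := leftover x M n (2 * k + 1) with hB
  set C := leftover x M (n + 1) k with hC
  set T := {i ∈ A | M i ∈ B} with hT
  have hAfin : A.Finite := leftover_finite hfin M _ _
  have hBfin : B.Finite := leftover_finite hfin M _ _
  have hTfin : T.Finite := hAfin.subset (sep_subset _ _)
  have hAB : Disjoint A B := Set.disjoint_left.2 fun i hi hi' => by
    have h1 := hi.1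
    have h2 := hi'.1
    omega
  have hinv := hM.1.1
  have hinj : Set.InjOn M T := (Function.LeftInverse.injective hinv).injOn
  have hTT : Disjoint T (M '' T) := Set.disjoint_left.2 fun i hi hi' => by
    obtain ⟨j, hj, rfl⟩ := hi'
    exact Set.disjoint_left.1 hAB hi.1 hj.2
  have hCmem : ∀ i, i ∈ C ↔ (i ∈ A ∧ M i ∉ B) ∨ (i ∈ B ∧ M i ∉ A) := mem_leftover_add_one hM n k
  have hCT : Disjoint C (T ∪ M '' T) := Set.disjoint_left.2 fun i hi hi' => by
    rcases hi' with hi' | ⟨j, hj, rfl⟩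
    · have h1 := Set.disjoint_left.1 hAB hi'.1
      have h2 := hi'.2
      rw [hCmem] at hi; tauto
    · have h1 := hj.1
      have h2 := Set.disjoint_right.1 hAB hj.2
      rw [hCmem, hinv] at hi; exact hi.elim (fun h => h2 h.1) (fun h => h.2 h1)
  have hunion : A ∪ B = C ∪ (T ∪ M '' T) := by
    ext i
    have hMT : i ∈ M '' T ↔ i ∈ B ∧ M i ∈ A := by
      constructor
      · rintro ⟨j, hj, rfl⟩; rw [hinv]; exact ⟨hj.2, hj.1⟩
      · rintro ⟨h1, h2⟩; exact ⟨M i, ⟨h2, by rwa [hinv]⟩, hinv i⟩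
    have hTi : i ∈ T ↔ i ∈ A ∧ M i ∈ B := Iff.rfl
    simp only [mem_union, hMT, hTi, hCmem]
    tauto
  have hsum : state x blue M n (2 * k) + state x blue M n (2 * k + 1) =
      state x blue M (n + 1) k + ∑ᶠ i ∈ T, (sgn (blue i) + sgn (blue (M i))) := by
    unfold state
    rw [← hA, ← hB, ← hC, ← finsum_mem_union hAB hAfin hBfin, hunion,
      finsum_mem_union hCT (leftover_finite hfin M _ _) (hTfin.union (hTfin.image _)),
      finsum_mem_union hTT hTfin (hTfin.image _), finsum_mem_image hinj,
      finsum_mem_add_distrib hTfin]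
  have hTsum : ∑ᶠ i ∈ T, (sgn (blue i) + sgn (blue (M i))) =
      -(if state x blue M n (2 * k) = -1 ∧ state x blue M n (2 * k + 1) = -1 then 2 else 0) := by
    split_ifs with h
    · rcases state_cases hx hfin hM n (2 * k) with ⟨r, hr, hAr, -⟩ | ⟨-, h'⟩
      swap; · omega
      rcases state_cases hx hfin hM n (2 * k + 1) with ⟨s, hs, hBs, -⟩ | ⟨-, h'⟩
      swap; · omega
      have hAr' : A = {r} := hAr
      have hBs' : B = {s} := hBs
      have hrs : r ≠ s := fun h => by
        rw [hAr', hBs', h] at hAB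
        exact Set.disjoint_left.1 hAB rfl rfl
      -- If unmatched to each other, the two reds would both be left over in the parent.
      have hMr : M r = s := by
        by_contra hne
        have hMs : M s ≠ r := fun h => hne (by rw [← h, hinv])
        have h1 : r ∈ C := (hCmem r).2 (Or.inl ⟨by rw [hAr']; rfl, by rw [hBs']; exact hne⟩)
        have h2 : s ∈ C := (hCmem s).2 (Or.inr ⟨by rw [hBs']; rfl, by rw [hAr']; exact hMs⟩)
        have := (blue_of_mem_leftover hx hM h1 h2 hrs).1
        simp [hr] at this
      have hTr : T = {r} := by
        ext i
        simp only [hT, hAr', hBs', mem_ofPred_eq, mem_singleton_iff]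
        exact ⟨fun h => h.1, fun h => ⟨h, h ▸ hMr⟩⟩
      rw [hTr, finsum_mem_singleton, hMr, hr, hs]; rfl
    · rw [neg_zero]
      refine (finsum_mem_congr rfl fun i hi => ?_).trans (finsum_mem_zero _)
      have hne : M i ≠ i := fun h' => Set.disjoint_left.1 hAB hi.1 (by simpa [h'] using hi.2)
      have hb := ((weight_lt_top_iff x blue _ _).1 (hM.1.2 i hne)).2
      -- A red-red cross pair would make both halves have state -1, the excluded case.
      have hr : ¬(blue i = false ∧ blue (M i) = false) := by
        rintro ⟨h1, h2⟩
        apply h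
        constructor
        · rcases state_cases hx hfin hM n (2 * k) with ⟨r, -, -, h'⟩ | ⟨h', -⟩
          · exact h'
          · simp [h' i hi.1] at h1
        · rcases state_cases hx hfin hM n (2 * k + 1) with ⟨r, -, -, h'⟩ | ⟨h', -⟩
          · exact h'
          · simp [h' _ hi.2] at h2
      cases h1 : blue i <;> cases h2 : blue (M i) <;> simp_all [sgn]
  rw [hTsum] at hsum
  unfold join
  omega

theorem merge_state (hx : ∀ i, 0 ≤ x i) (hfin : ∀ n k, {i | cell n (x i) = k}.Finite)
    (hM : M ∈ stableMatchings x blue) (n : ℤ) (h : ℕ) :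
    (fun k : ℕ => state x blue M (n + h) k) = merge^[h] (fun k : ℕ => state x blue M n k) := by
  induction h with
  | zero => simp
  | succ h ih =>
    rw [Function.iterate_succ_apply', ← ih]
    funext k
    rw [Nat.cast_succ, ← add_assoc, state_add_one hx hfin hM]
    simp [merge]

/-- A lone point cannot be matched inside its cell, so here the state is the same for every map `M`;
stability is not needed. -/
theorem state_eq_label {n k : ℤ} (hsub : {i | cell n (x i) = k}.Subsingleton)
    (blue : V → Bool) (M : V → V) : state x blue M n k = label x blue n k := by
  by_cases hne : ∃ i, cell n (x i) = k
  · obtain ⟨i, hi⟩ := hne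
    have huniq : ∀ j, cell n (x j) = k → j = i := fun j hj => hsub hj hi
    have hL : leftover x M n k = {i} := by
      ext j
      refine ⟨fun h => huniq j h.1, fun h => ?_⟩
      rw [mem_singleton_iff] at h
      subst h
      refine ⟨hi, ?_⟩
      by_cases h : cell n (x (M j)) = k
      · exact Or.inl (huniq _ h)
      · exact Or.inr h
    rw [state, hL, finsum_mem_singleton, label]
    cases hb : blue i
    · rw [if_neg, if_pos ⟨i, hi, hb, huniq⟩]; · rfl
      rintro ⟨j, hj, hjb, -⟩
      rw [huniq j hj, hb] at hjb
      cases hjb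
    · rw [if_pos ⟨i, hi, hb, huniq⟩]; rfl
  · push Not at hne
    have hL : leftover x M n k = ∅ := eq_empty_of_forall_notMem fun i hi => hne i hi.1
    rw [state, hL, finsum_mem_empty, label, if_neg, if_neg, if_pos hne]
    · rintro ⟨j, hj, -⟩; exact hne j hj
    · rintro ⟨j, hj, -⟩; exact hne j hj

end Stable

/-! ### Iterated merging and fine meshes -/

theorem merge_iterate_congr {s s' : ℕ → ℤ} (h k : ℕ)
    (hs : ∀ i, k * 2 ^ h ≤ i → i < (k + 1) * 2 ^ h → s i = s' i) :
    merge^[h] s k = merge^[h] s' k := by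
  induction h generalizing k with
  | zero => exact hs k (by simp) (by simp)
  | succ h ih =>
    rw [Function.iterate_succ_apply', Function.iterate_succ_apply']
    rw [merge, merge, ih (2 * k), ih (2 * k + 1)]
    · intro i h1 h2
      refine hs i (le_trans ?_ h1) (h2.trans_le ?_)
      · rw [pow_succ]; nlinarith [Nat.two_pow_pos h]
      · rw [pow_succ]; nlinarith
    · intro i h1 h2
      refine hs i (le_trans ?_ h1) (h2.trans_le ?_)
      · rw [pow_succ]; nlinarith
      · rw [pow_succ]; nlinarith [Nat.two_pow_pos h]

/-- Superadditivity: `join a b` is at least `a + b`. This turns laws of large numbers for one level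
into lower bounds at higher levels. -/
theorem sum_le_merge_iterate (s : ℕ → ℤ) (h k : ℕ) :
    ∑ i ∈ Finset.Ico (k * 2 ^ h) ((k + 1) * 2 ^ h), s i ≤ merge^[h] s k := by
  induction h generalizing k with
  | zero => simp
  | succ h ih =>
    rw [Function.iterate_succ_apply', merge, join]
    have h1 := ih (2 * k)
    have h2 := ih (2 * k + 1)
    have h3 := Finset.sum_Ico_consecutive s
      (show 2 * k * 2 ^ h ≤ (2 * k + 1) * 2 ^ h from Nat.mul_le_mul_right _ (by omega))
      (show (2 * k + 1) * 2 ^ h ≤ (2 * k + 1 + 1) * 2 ^ h from Nat.mul_le_mul_right _ (by omega))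
    rw [show k * 2 ^ (h + 1) = 2 * k * 2 ^ h by ring,
      show (k + 1) * 2 ^ (h + 1) = (2 * k + 1 + 1) * 2 ^ h by ring, ← h3]
    split_ifs <;> omega

/-- On fine meshes the labels determine the states of the unit intervals. -/
theorem eventually_merge_label_eq_state {V : Type*} {x : V → ℝ} (hx : ∀ i, 0 ≤ x i)
    (hinj : Function.Injective x) (hfin : ∀ n k, {i | cell n (x i) = k}.Finite)
    {blue : V → Bool} {M : V → V} (hM : M ∈ stableMatchings x blue) (k : ℕ) :
    ∀ᶠ m : ℕ in atTop,
      merge^[m] (fun j : ℕ => label x blue (-m) j) k = state x blue M 0 k := by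
  -- The interval holds finitely many distinct points, so all pairs are eventually in different
  -- cells.
  have hsep : ∀ᶠ m : ℕ in atTop, ∀ q ∈ {i | cell 0 (x i) = k} ×ˢ {i | cell 0 (x i) = k},
      cell (-m) (x q.1) = cell (-m) (x q.2) → q.1 = q.2 := by
    refine (Filter.eventually_all_finite ((hfin _ _).prod (hfin _ _))).2 fun q _ => ?_
    by_cases hq : q.1 = q.2
    · exact Eventually.of_forall fun _ _ => hq
    obtain ⟨n, hn⟩ := exists_cell_ne (hinj.ne hq)
    filter_upwards [eventually_ge_atTop (-n).toNat] with m hm h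
    exact absurd (cell_eq_mono (by omega) h) hn
  filter_upwards [hsep] with m hm
  have h0 := congrFun (merge_state hx hfin hM (-m) m) k
  rw [neg_add_cancel] at h0
  rw [h0]
  refine merge_iterate_congr m k fun j h1 h2 => (state_eq_label (fun a ha b hb => ?_) blue M).symm
  have hj : (j : ℤ) / 2 ^ m = k := by
    have : j / 2 ^ m = k := Nat.div_eq_of_lt_le h1 h2
    exact_mod_cast this
  have h3 : ∀ a, cell (-m) (x a) = j → cell 0 (x a) = k := fun a ha => by
    rw [← neg_add_cancel (m : ℤ), cell_add_nat, ha, hj]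
  exact hm (a, b) ⟨h3 a ha, h3 b hb⟩ (ha.trans hb.symm)

/-! ### Unmatched blue points, and symmetries that change a matching -/

section Stable

variable {V : Type*} {x : V → ℝ} {blue : V → Bool} {M : V → V}

/-- If the sibling intervals `[2 ^ n, 2 ^ (n + 1))`, `n ≥ N`, have no red point left over, then the
points left over in `[0, 2 ^ N)` are unmatched. -/
theorem leftover_subset_unmatchedBlue (hx : ∀ i, 0 ≤ x i)
    (hfin : ∀ n k, {i | cell n (x i) = k}.Finite) (hM : M ∈ stableMatchings x blue) (N : ℤ)
    (hN : 0 < state x blue M N 0) (hsib : ∀ n, N ≤ n → 0 ≤ state x blue M n 1) :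
    leftover x M N 0 ⊆ unmatchedBlue blue M := by
  intro i hi
  have hblue : blue i = true := by
    rcases state_cases hx hfin hM N 0 with ⟨r, -, -, h⟩ | ⟨h, -⟩
    · omega
    · exact h i hi
  refine ⟨hblue, ?_⟩
  by_contra hne
  have h0 : ∀ n : ℤ, cell n 0 = 0 := fun n => by simp [cell]
  have hex := exists_cell_eq_zero (hx (M i)) N
  classical
  -- At the first level where the partner joins the cell at the origin, it comes from the sibling
  -- with index 1 one level below.
  set m := Nat.find hex with hm
  have hm1 : cell (N + m) (x (M i)) = 0 := Nat.find_spec hex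
  have hm0 : m ≠ 0 := fun h => by
    rw [h, Nat.cast_zero, add_zero] at hm1
    exact (hi.2.resolve_left hne) hm1
  obtain ⟨l, hl⟩ := Nat.exists_eq_succ_of_ne_zero hm0
  have hl1 : cell (N + l) (x (M i)) ≠ 0 := Nat.find_min hex (by omega)
  have hl2 : cell (N + l) (x (M i)) = 1 := by
    rw [hl, Nat.cast_succ, ← add_assoc, cell_add_one] at hm1
    omega
  have hi0 : cell (N + l) (x i) = 0 := by
    rw [← h0 (N + l)]
    exact cell_eq_mono (by omega) (hi.1.trans (h0 N).symm)
  have hMi : M i ∈ leftover x M (N + l) 1 := ⟨hl2, Or.inr (by rw [hM.1.1, hi0]; norm_num)⟩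
  rcases state_cases hx hfin hM (N + l) 1 with ⟨r, -, -, h⟩ | ⟨h, -⟩
  · have := hsib (N + l) (by omega)
    omega
  · exact ((weight_lt_top_iff x blue _ _).1 (hM.1.2 i hne)).2 ⟨hblue, h _ hMi⟩

/-- Stability is expressed through the weights alone, so a weight-preserving involution transports
it. -/
theorem conj_mem_stableMatchings {σ : V → V} (hσ : ∀ i, σ (σ i) = i)
    (hw : ∀ i j, weight x blue (σ i) (σ j) = weight x blue i j)
    (hM : M ∈ stableMatchings x blue) : (fun i => σ (M (σ i))) ∈ stableMatchings x blue := by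
  have hd : ∀ i, weight x blue i (σ (M (σ i))) = weight x blue (σ i) (M (σ i)) := fun i => by
    rw [← hw (σ i), hσ]
  refine ⟨⟨fun i => ?_, fun i hi => ?_⟩, fun i j => ?_⟩
  · simp only [hσ, hM.1.1]
  · rw [hd]
    refine hM.1.2 _ fun h => hi ?_
    simp only [h, hσ]
  · simp only [hd]
    rw [← hw i j]
    exact hM.2 _ _

theorem weight_swap [DecidableEq V] {u v : V} (hu : blue u = true) (hv : blue v = true)
    (h : ∀ z, z ≠ u → z ≠ v → rho (x z) (x u) = rho (x z) (x v)) (i j : V) :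
    weight x blue (Equiv.swap u v i) (Equiv.swap u v j) = weight x blue i j := by
  have hz : ∀ z, z ≠ u → z ≠ v → weight x blue z u = weight x blue z v := fun z h1 h2 => by
    unfold weight
    rw [h z h1 h2]
    simp [h1, h2, hu, hv]
  have hz' : ∀ z, z ≠ u → z ≠ v → weight x blue u z = weight x blue v z := fun z h1 h2 => by
    rw [weight_comm, hz z h1 h2, weight_comm]
  simp only [Equiv.swap_apply_def]
  split_ifs with h1 h2 h3 h4 h5 h6 h7 h8 <;> subst_vars <;>
    first
    | rfl
    | rw [weight_self, weight_self]
    | exact weight_comm _ _ _ _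
    | (symm; apply hz' <;> assumption)
    | (apply hz' <;> assumption)
    | (symm; apply hz <;> assumption)
    | (apply hz <;> assumption)

theorem exists_unique_of_label_eq_one {n k : ℤ} (h : label x blue n k = 1) :
    ∃ i, cell n (x i) = k ∧ blue i = true ∧ ∀ j, cell n (x j) = k → j = i := by
  unfold label at h
  split_ifs at h with h1 h2 h3
  · exact h1
  all_goals norm_num at h

theorem exists_unique_of_label_eq_neg_one {n k : ℤ} (h : label x blue n k = -1) :
    ∃ i, cell n (x i) = k ∧ blue i = false ∧ ∀ j, cell n (x j) = k → j = i := by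
  unfold label at h
  split_ifs at h with h1 h2 h3
  · exact h2

theorem cell_ne_of_label_eq_zero {n k : ℤ} (h : label x blue n k = 0) (i : V) :
    cell n (x i) ≠ k := by
  unfold label at h
  split_ifs at h with h1 h2 h3 <;> first | exact h3 i | omega

/-- The `k`-th interval of length four has a single red point in its first quarter, none in its
second, and single blue points in its third and its fourth. -/
def IsGadget (x : V → ℝ) (blue : V → Bool) (k : ℕ) : Prop :=
  label x blue 0 (4 * k : ℤ) = -1 ∧ label x blue 0 (4 * k + 1 : ℤ) = 0 ∧
    label x blue 0 (4 * k + 2 : ℤ) = 1 ∧ label x blue 0 (4 * k + 3 : ℤ) = 1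

/-- The red point takes one of the two blues, and these are interchangeable: each is alone in its
unit cell and they share every coarser cell. -/
theorem IsGadget.exists_points (hx : ∀ i, 0 ≤ x i) (hinj : Function.Injective x)
    (hM : M ∈ stableMatchings x blue) {k : ℕ} (hk : IsGadget x blue k) :
    ∃ r u v, cell 0 (x r) = 4 * k ∧ cell 0 (x u) = 4 * k + 2 ∧ cell 0 (x v) = 4 * k + 3 ∧
      blue u = true ∧ blue v = true ∧ (M r = u ∨ M r = v) ∧
      ∀ z, z ≠ u → z ≠ v → rho (x z) (x u) = rho (x z) (x v) := by
  obtain ⟨h1, h2, h3, h4⟩ := hk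
  obtain ⟨r, hr, hrb, hr'⟩ := exists_unique_of_label_eq_neg_one h1
  obtain ⟨u, hu, hub, hu'⟩ := exists_unique_of_label_eq_one h3
  obtain ⟨v, hv, hvb, hv'⟩ := exists_unique_of_label_eq_one h4
  have he := cell_ne_of_label_eq_zero h2
  refine ⟨r, u, v, hr, hu, hv, hub, hvb, ?_, ?_⟩
  -- Otherwise `r` and `u` have no partner inside the interval of length four, and they form a
  -- blocking pair.
  · by_contra! hne
    have hcell : ∀ i, cell 2 (x i) = cell 0 (x i) / 4 := fun i => by
      have := cell_add_nat 0 2 (x i)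
      norm_num at this
      exact this
    have hin : ∀ i, cell 2 (x i) = k → i = r ∨ i = u ∨ i = v := fun i hi => by
      rw [hcell] at hi
      have : cell 0 (x i) = 4 * k ∨ cell 0 (x i) = 4 * k + 1 ∨ cell 0 (x i) = 4 * k + 2 ∨
        cell 0 (x i) = 4 * k + 3 := by omega
      rcases this with h | h | h | h
      · exact Or.inl (hr' i h)
      · exact absurd h (he i)
      · exact Or.inr (Or.inl (hu' i h))
      · exact Or.inr (Or.inr (hv' i h))
    have hr2 : cell 2 (x r) = k := by rw [hcell]; omega
    have hu2 : cell 2 (x u) = k := by rw [hcell]; omega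
    have hru : r ≠ u := fun h => by rw [h, hub] at hrb; cases hrb
    have hdr : ENNReal.ofReal (2 ^ (2 : ℤ)) < weight x blue r (M r) := by
      rw [← not_le, weight_le_iff hx, weight_lt_top_iff]
      rintro ⟨⟨h1, -⟩, h2⟩
      rcases hin (M r) (by rw [← h2, hr2]) with h | h | h
      · exact h1 h.symm
      · exact hne.1 h
      · exact hne.2 h
    have hdu : ENNReal.ofReal (2 ^ (2 : ℤ)) < weight x blue u (M u) := by
      rw [← not_le, weight_le_iff hx, weight_lt_top_iff]
      rintro ⟨⟨h1, h1'⟩, h2⟩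
      rcases hin (M u) (by rw [← h2, hu2]) with h | h | h
      · exact hne.1 (by rw [← h, hM.1.1])
      · exact h1 h.symm
      · exact h1' ⟨hub, by rw [h, hvb]⟩
    have hw : weight x blue r u ≤ ENNReal.ofReal (2 ^ (2 : ℤ)) :=
      (weight_le_iff hx blue r u 2).2
        ⟨(weight_lt_top_iff x blue r u).2 ⟨hru, by simp [hrb]⟩, hr2.trans hu2.symm⟩
    exact (lt_min hdr hdu).not_ge ((hM.2 r u).trans hw)
  · intro z hzu hzv
    have huv : cell 1 (x u) = cell 1 (x v) := by
      have a := cell_add_one 0 (x u)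
      have b := cell_add_one 0 (x v)
      rw [zero_add] at a b
      omega
    have key : ∀ n, cell n (x z) = cell n (x u) ↔ cell n (x z) = cell n (x v) := fun n => by
      rcases lt_or_ge 0 n with hn | hn
      · rw [cell_eq_mono (show 1 ≤ n by omega) huv]
      · constructor
        · intro h
          exact absurd (hu' z ((cell_eq_mono hn h).trans hu)) hzu
        · intro h
          exact absurd (hv' z ((cell_eq_mono hn h).trans hv)) hzv
    unfold rho
    rw [if_neg (hinj.ne hzu), if_neg (hinj.ne hzv)]
    congr 3
    ext n
    simpa [cell] using key (-n)

theorem infinite_stableMatchings (hx : ∀ i, 0 ≤ x i) (hinj : Function.Injective x)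
    (hne : (stableMatchings x blue).Nonempty) (hK : {k | IsGadget x blue k}.Infinite) :
    (stableMatchings x blue).Infinite := by
  classical
  obtain ⟨M, hM⟩ := hne
  have hex : ∀ k : ℕ, ∃ q : V × V × V, IsGadget x blue k →
      cell 0 (x q.1) = 4 * k ∧ cell 0 (x q.2.1) = 4 * k + 2 ∧ cell 0 (x q.2.2) = 4 * k + 3 ∧
      blue q.2.1 = true ∧ blue q.2.2 = true ∧ (M q.1 = q.2.1 ∨ M q.1 = q.2.2) ∧
      ∀ z, z ≠ q.2.1 → z ≠ q.2.2 → rho (x z) (x q.2.1) = rho (x z) (x q.2.2) := fun k => by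
    by_cases hk : IsGadget x blue k
    · obtain ⟨r, u, v, h⟩ := hk.exists_points hx hinj hM
      exact ⟨(r, u, v), fun _ => h⟩
    · obtain ⟨k', hk'⟩ := hK.nonempty
      obtain ⟨r, -⟩ := hk'.exists_points hx hinj hM
      -- Arbitrary value off the gadgets; a gadget elsewhere supplies an element of `V`.
      exact ⟨(r, r, r), fun h => absurd h hk⟩
  choose q hq using hex
  refine infinite_of_injOn_mapsTo
    (f := fun k i => Equiv.swap (q k).2.1 (q k).2.2 (M (Equiv.swap (q k).2.1 (q k).2.2 i)))
    ?_ (fun k hk => ?_) hK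
  -- Compare partners of the red point of gadget `k`: the swap in `k` changes its partner, the swap
  -- in another gadget `l` does not.
  · intro k hk l hl hkl
    by_contra hne
    obtain ⟨r1, u1, v1, -, -, hm, -⟩ := hq k hk
    obtain ⟨-, u2, v2, -⟩ := hq l hl
    have hneq : ∀ {a b : V}, cell 0 (x a) ≠ cell 0 (x b) → a ≠ b := fun h h' => h (by rw [h'])
    have h := congrFun hkl (q k).1
    simp only at h
    rw [Equiv.swap_apply_of_ne_of_ne (x := (q k).1) (hneq (by omega)) (hneq (by omega)),
      Equiv.swap_apply_of_ne_of_ne (x := (q k).1) (hneq (by omega)) (hneq (by omega))] at h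
    have huv : (q k).2.1 ≠ (q k).2.2 := hneq (by omega)
    rcases hm with hm | hm
    · rw [hm, Equiv.swap_apply_left,
        Equiv.swap_apply_of_ne_of_ne (hneq (by omega)) (hneq (by omega))] at h
      exact huv h.symm
    · rw [hm, Equiv.swap_apply_right,
        Equiv.swap_apply_of_ne_of_ne (hneq (by omega)) (hneq (by omega))] at h
      exact huv h
  · obtain ⟨-, -, -, hu, hv, -, hz⟩ := hq k hk
    exact conj_mem_stableMatchings (Equiv.swap_apply_self _ _) (weight_swap hu hv hz) hM

end Stable

/-! ### I.i.d. sequences: grouping, limits, averages -/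

section IID

variable {Ω α β : Type*} [MeasurableSpace Ω] [MeasurableSpace α] [MeasurableSpace β]
  {P : Measure Ω}

/-- A sequence of independent random variables with the same law. -/
structure IsIID (P : Measure Ω) (s : ℕ → Ω → α) : Prop where
  measurable : ∀ k, Measurable (s k)
  indep : iIndepFun s P
  law : ∀ k, P.map (s k) = P.map (s 0)

theorem IsIID.identDistrib {s : ℕ → Ω → α} (hs : IsIID P s) (i j : ℕ) :
    IdentDistrib (s i) (s j) P P where
  aemeasurable_fst := (hs.measurable i).aemeasurable
  aemeasurable_snd := (hs.measurable j).aemeasurable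
  map_eq := by rw [hs.law i, hs.law j]

theorem IsIID.comp {s : ℕ → Ω → α} (hs : IsIID P s) {g : α → β} (hg : Measurable g) :
    IsIID P (fun k ω => g (s k ω)) where
  measurable k := hg.comp (hs.measurable k)
  indep := hs.indep.comp (fun _ => g) (fun _ => hg)
  law k := ((hs.identDistrib k 0).comp hg).map_eq

theorem iIndepFun_curry [IsProbabilityMeasure P] {ι κ : Type*} {X : ι × κ → Ω → α}
    (mX : ∀ q, Measurable (X q)) (h : iIndepFun X P) :
    iIndepFun (fun i ω j => X (i, j) ω) P := by
  have : ∀ q, IsProbabilityMeasure (P.map (X q)) :=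
    fun q => Measure.isProbabilityMeasure_map (mX q).aemeasurable
  have hj : ∀ i, P.map (fun ω j => X (i, j) ω) = Measure.infinitePi fun j => P.map (X (i, j)) :=
    fun i => (h.precomp (g := fun j => (i, j)) (fun a b h => (Prod.ext_iff.1 h).2)
      ).map_fun_eq_infinitePi_map fun j => mX (i, j)
  rw [iIndepFun_iff_map_fun_eq_infinitePi_map (fun i => by fun_prop)]
  simp_rw [hj]
  rw [← Measure.infinitePi_map_curry (fun i j => P.map (X (i, j))),
    ← h.map_fun_eq_infinitePi_map mX, Measure.map_map (by fun_prop) (by fun_prop)]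
  rfl

/-- Grouping an i.i.d. sequence into consecutive pairs gives an i.i.d. sequence. -/
theorem IsIID.pair [IsProbabilityMeasure P] {s : ℕ → Ω → α} (hs : IsIID P s) :
    IsIID P (fun k ω => (s (2 * k) ω, s (2 * k + 1) ω)) where
  measurable k := (hs.measurable _).prodMk (hs.measurable _)
  indep := by
    have hinj : Function.Injective (fun q : ℕ × Bool => 2 * q.1 + q.2.toNat) := by
      rintro ⟨a, b⟩ ⟨c, d⟩ h
      cases b <;> cases d <;> simp at h ⊢ <;> omega
    have h := iIndepFun_curry (X := fun q : ℕ × Bool => s (2 * q.1 + q.2.toNat))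
      (fun _ => hs.measurable _) (hs.indep.precomp hinj)
    exact h.comp (fun _ f => (f false, f true)) (fun _ => by fun_prop)
  law k := by
    have hm := fun i => (hs.measurable i).aemeasurable (μ := P)
    have h : ∀ k, P.map (fun ω => (s (2 * k) ω, s (2 * k + 1) ω)) =
        (P.map (s 0)).prod (P.map (s 0)) := fun k => by
      have := (indepFun_iff_map_prod_eq_prod_map_map (hm _) (hm _)).1
        (hs.indep.indepFun (show 2 * k ≠ 2 * k + 1 by omega))
      rw [this, hs.law (2 * k), hs.law (2 * k + 1)]
    rw [h, h]

theorem iIndepFun_of_singletons [IsProbabilityMeasure P] [Countable α] [DiscreteMeasurableSpace α]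
    [Inhabited α] {s : ℕ → Ω → α} (hm : ∀ k, Measurable (s k))
    (h : ∀ (T : Finset ℕ) (a : ℕ → α), P {ω | ∀ j ∈ T, s j ω = a j} =
      ∏ j ∈ T, P {ω | s j ω = a j}) : iIndepFun s P := by
  classical
  rw [iIndepFun_iff_finset]
  intro T
  have : ∀ k, IsProbabilityMeasure (P.map (s k)) :=
    fun k => Measure.isProbabilityMeasure_map (hm k).aemeasurable
  refine (iIndepFun_iff_map_fun_eq_pi_map (f := T.restrict s)
    (fun i => (hm i).aemeasurable)).2 ?_
  refine Measure.ext_of_singleton fun a => ?_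
  have hset : ∀ (k : ℕ) (b : α), P.map (s k) {b} = P {ω | s k ω = b} := fun k b =>
    Measure.map_apply (hm k) (measurableSet_singleton b)
  have hmeas : Measurable fun ω (i : T) => T.restrict s i ω :=
    measurable_pi_lambda _ fun i => hm i
  rw [Measure.pi_singleton, Measure.map_apply hmeas (measurableSet_singleton a)]
  let a' : ℕ → α := fun j => if hj : j ∈ T then a ⟨j, hj⟩ else default
  have ha' : ∀ j : T, a' j = a j := fun j => by simp [a']
  have h1 := h T a'
  rw [← Finset.prod_coe_sort T (fun j => P {ω | s j ω = a' j})] at h1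
  have h2 : (fun ω (i : T) => T.restrict s i ω) ⁻¹' {a} = {ω | ∀ j ∈ T, s j ω = a' j} := by
    ext ω
    simp only [mem_preimage, mem_singleton_iff, funext_iff, mem_ofPred_eq, Finset.restrict]
    exact ⟨fun h j hj => (h ⟨j, hj⟩).trans (ha' ⟨j, hj⟩).symm,
      fun h j => by rw [h j j.2, ha']⟩
  rw [h2, h1]
  exact Finset.prod_congr rfl fun j _ => by rw [ha', ← hset]; rfl

/-- Finite-dimensional point probabilities converge by dominated convergence of indicators, so the
product formula and the common law pass to the limit. -/
theorem IsIID.of_eventually_eq [IsProbabilityMeasure P] [Countable α] [DiscreteMeasurableSpace α]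
    [Inhabited α] {s : ℕ → ℕ → Ω → α} (hs : ∀ m, IsIID P (s m)) {S : ℕ → Ω → α}
    (hS : ∀ k, Measurable (S k)) (hlim : ∀ᵐ ω ∂P, ∀ k, ∀ᶠ m in atTop, s m k ω = S k ω) :
    IsIID P S := by
  have hmeas : ∀ (f : ℕ → Ω → α) (hf : ∀ k, Measurable (f k)) (T : Finset ℕ) (a : ℕ → α),
      MeasurableSet {ω | ∀ j ∈ T, f j ω = a j} := fun f hf T a => by
    have : {ω | ∀ j ∈ T, f j ω = a j} = ⋂ j ∈ T, f j ⁻¹' {a j} := by ext; simp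
    rw [this]
    exact Finset.measurableSet_biInter _ fun j _ => hf j (measurableSet_singleton _)
  have htend : ∀ (T : Finset ℕ) (a : ℕ → α),
      Tendsto (fun m => P {ω | ∀ j ∈ T, s m j ω = a j}) atTop (nhds (P {ω | ∀ j ∈ T, S j ω = a j})) :=
    fun T a => by
    refine tendsto_measure_of_ae_tendsto_indicator_of_isFiniteMeasure atTop (hmeas S hS T a)
      (fun m => hmeas _ (hs m).measurable T a) ?_
    filter_upwards [hlim] with ω hω
    filter_upwards [(Filter.eventually_all_finset T).2 fun j _ => hω j] with m hm
    exact forall₂_congr fun j hj => by rw [hm j hj]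
  have htend1 : ∀ (j : ℕ) (b : α),
      Tendsto (fun m => P {ω | s m j ω = b}) atTop (nhds (P {ω | S j ω = b})) := fun j b => by
    simpa using htend {j} (fun _ => b)
  refine ⟨hS, iIndepFun_of_singletons hS fun T a => ?_, fun k => ?_⟩
  · refine tendsto_nhds_unique (htend T a) ?_
    have : ∀ m, P {ω | ∀ j ∈ T, s m j ω = a j} = ∏ j ∈ T, P {ω | s m j ω = a j} := fun m => by
      have := (hs m).indep.measure_inter_preimage_eq_mul T (sets := fun j => {a j})
        (fun _ _ => measurableSet_singleton _)
      convert! this using 2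
      ext; simp
    simp_rw [this]
    exact ENNReal.tendsto_finsetProd_of_ne_top T (fun j _ => htend1 j (a j))
      (fun j _ => measure_ne_top _ _)
  · refine Measure.ext_of_singleton fun b => ?_
    have hset : ∀ f : Ω → α, Measurable f → P.map f {b} = P {ω | f ω = b} := fun f hf =>
      Measure.map_apply hf (measurableSet_singleton b)
    rw [hset _ (hS k), hset _ (hS 0)]
    refine tendsto_nhds_unique (htend1 k b) ?_
    have : ∀ m, P {ω | s m k ω = b} = P {ω | s m 0 ω = b} := fun m => by
      rw [← hset _ ((hs m).measurable k), ← hset _ ((hs m).measurable 0), (hs m).law k]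
    simp_rw [this]
    exact htend1 0 b

theorem IsIID.tendsto_average {s : ℕ → Ω → ℝ} (hs : IsIID P s) (hint : Integrable (s 0) P) :
    ∀ᵐ ω ∂P, Tendsto (fun n : ℕ => (∑ i ∈ Finset.range n, s i ω) / n) atTop
      (nhds (∫ ω, s 0 ω ∂P)) :=
  strong_law_ae_real s hint (fun _ _ hij => hs.indep.indepFun hij) (fun i => hs.identDistrib i 0)

/-- An event of positive probability in an i.i.d. sequence occurs infinitely often. -/
theorem IsIID.infinite_setOf_mem [IsProbabilityMeasure P] {s : ℕ → Ω → α} (hs : IsIID P s)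
    {A : Set α} (hA : MeasurableSet A) (hpos : 0 < P {ω | s 0 ω ∈ A}) :
    ∀ᵐ ω ∂P, {k | s k ω ∈ A}.Infinite := by
  have hmeas : MeasurableSet {ω | s 0 ω ∈ A} := hs.measurable 0 hA
  have h1 : IsIID P (fun k ω => A.indicator (fun _ => (1 : ℝ)) (s k ω)) :=
    hs.comp (measurable_const.indicator hA)
  have hi : (fun ω => A.indicator (fun _ => (1 : ℝ)) (s 0 ω)) =
      {ω | s 0 ω ∈ A}.indicator (fun _ => (1 : ℝ)) := by
    ext ω; simp [indicator]
  have hint : Integrable (fun ω => A.indicator (fun _ => (1 : ℝ)) (s 0 ω)) P := by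
    rw [hi]; exact (integrable_const _).indicator hmeas
  have hmean : 0 < ∫ ω, A.indicator (fun _ => (1 : ℝ)) (s 0 ω) ∂P := by
    rw [hi, integral_indicator_const _ hmeas]
    rw [smul_eq_mul, mul_one]
    exact ENNReal.toReal_pos hpos.ne' (measure_ne_top _ _)
  filter_upwards [h1.tendsto_average hint] with ω hω
  -- With finitely many occurrences the averages tend to 0, against the positive mean given by the
  -- strong law.
  by_contra hfin
  rw [Set.not_infinite] at hfin
  have hbound : ∀ n : ℕ, (∑ i ∈ Finset.range n, A.indicator (fun _ => (1 : ℝ)) (s i ω)) ≤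
      hfin.toFinset.card := fun n => by
    classical
    have : ∀ i, A.indicator (fun _ => (1 : ℝ)) (s i ω) = if s i ω ∈ A then 1 else 0 := fun i => by
      simp [indicator]
    simp_rw [this]
    rw [Finset.sum_boole]
    exact_mod_cast Finset.card_le_card fun i hi => by simpa using (Finset.mem_filter.1 hi).2
  have hzero : Tendsto (fun n : ℕ => (∑ i ∈ Finset.range n,
      A.indicator (fun _ => (1 : ℝ)) (s i ω)) / n) atTop (nhds 0) := by
    refine squeeze_zero (fun n => ?_) (fun n => div_le_div_of_nonneg_right (hbound n) (by positivity))
      (tendsto_const_div_atTop_nhds_zero_nat _)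
    exact div_nonneg (Finset.sum_nonneg fun i _ => indicator_nonneg (fun _ _ => zero_le_one) _)
      (by positivity)
  exact hmean.ne' (tendsto_nhds_unique hω hzero)

end IID

/-! ### Growth of the mean positive part under merging -/

section

/-- The hypotheses give a gain over b of at least b(1 - 2q) + q(b - x), where 1 - 2q ≥ 2x. If q ≤
1/4 the first term suffices. If not, then either x ≥ δ/2 and the first term is at least δ², or b - x
≥ δ/2 and the second is at least δ/8. -/
theorem growth_arith {q b x β δ : ℝ} (hq : 0 ≤ q) (hx : 0 ≤ x) (hqx : q + x ≤ 1 / 2)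
    (hxb : x ≤ b) (hbβ : (b - x) / 2 ≤ b - β) (hδ : 0 < δ) (hδ1 : δ ≤ 1) (hδb : δ ≤ b) :
    b + δ ^ 2 / 8 ≤ 2 * b - 2 * (q * β) := by
  have h1 : b * (2 * x) ≤ b * (1 - 2 * q) := mul_le_mul_of_nonneg_left (by linarith) (by linarith)
  have h2 : q * (b - x) ≤ q * (2 * (b - β)) := mul_le_mul_of_nonneg_left (by linarith) hq
  have h3 : 0 ≤ q * (b - x) := mul_nonneg hq (by linarith)
  have h4 : 0 ≤ b * (2 * x) := mul_nonneg (by linarith) (by linarith)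
  have h5 : δ ^ 2 ≤ δ := by nlinarith
  rcases le_total q (1 / 4) with h | h
  · have : b * (1 / 2) ≤ b * (1 - 2 * q) := mul_le_mul_of_nonneg_left (by linarith) (by linarith)
    nlinarith
  · rcases le_total (δ / 2) x with h' | h'
    · have : δ * (2 * (δ / 2)) ≤ b * (2 * x) :=
        mul_le_mul hδb (by linarith) (by positivity) (by linarith)
      nlinarith
    · have : 1 / 4 * (δ / 2) ≤ q * (b - x) :=
        mul_le_mul h (by linarith) (by positivity) hq
      nlinarith

variable {Ω : Type*} [MeasurableSpace Ω] {P : Measure Ω}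

/-- The indicator of a set of integers, as a real number. -/
noncomputable def ind (A : Set ℤ) (a : ℤ) : ℝ := A.indicator (fun _ => 1) a

theorem ind_nonneg (A : Set ℤ) (a : ℤ) : 0 ≤ ind A a := indicator_nonneg (fun _ _ => zero_le_one) _

theorem ind_le_one (A : Set ℤ) (a : ℤ) : ind A a ≤ 1 :=
  indicator_le_self' (fun _ _ => zero_le_one) _

theorem integrable_ind [IsProbabilityMeasure P] {f : Ω → ℤ} (hf : Measurable f) (A : Set ℤ) :
    Integrable (fun ω => ind A (f ω)) P := by
  refine Integrable.of_bound ((measurable_of_countable (ind A)).comp hf).aestronglyMeasurable 1 ?_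
  filter_upwards with ω
  rw [Real.norm_of_nonneg (ind_nonneg _ _)]
  exact ind_le_one _ _

theorem integral_ind_nonneg (f : Ω → ℤ) (A : Set ℤ) : 0 ≤ ∫ ω, ind A (f ω) ∂P :=
  integral_nonneg fun _ => ind_nonneg _ _

theorem integral_ind_le_one [IsProbabilityMeasure P] {f : Ω → ℤ} (hf : Measurable f) (A : Set ℤ) :
    ∫ ω, ind A (f ω) ∂P ≤ 1 := by
  have := integral_mono (integrable_ind (P := P) hf A) (integrable_const 1) fun ω => ind_le_one A _
  simpa using this

theorem IsIID.integral_comp_eq {s : ℕ → Ω → ℤ} (hs : IsIID P s) (g : ℤ → ℝ) (i j : ℕ) :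
    ∫ ω, g (s i ω) ∂P = ∫ ω, g (s j ω) ∂P :=
  ((hs.identDistrib i j).comp (measurable_of_countable g)).integral_eq

theorem IsIID.integral_mul [IsProbabilityMeasure P] {s : ℕ → Ω → ℤ} (hs : IsIID P s) (g h : ℤ → ℝ) :
    ∫ ω, g (s 0 ω) * h (s 1 ω) ∂P = (∫ ω, g (s 0 ω) ∂P) * ∫ ω, h (s 0 ω) ∂P := by
  have hg := measurable_of_countable g
  have hh := measurable_of_countable h
  rw [hs.integral_comp_eq h 0 1]
  exact ((hs.indep.indepFun zero_ne_one).comp hg hh).integral_fun_mul_eq_mul_integral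
    (hg.comp (hs.measurable 0)).aestronglyMeasurable
    (hh.comp (hs.measurable 1)).aestronglyMeasurable

/-- The pathwise version of `merge`. -/
def mergeProcess {Ω : Type*} (s : ℕ → Ω → ℤ) (k : ℕ) (ω : Ω) : ℤ := merge (fun j => s j ω) k

theorem mergeProcess_iterate {Ω : Type*} (s : ℕ → Ω → ℤ) (h k : ℕ) (ω : Ω) :
    mergeProcess^[h] s k ω = merge^[h] (fun j => s j ω) k := by
  induction h generalizing k with
  | zero => rfl
  | succ h ih =>
    rw [Function.iterate_succ_apply', Function.iterate_succ_apply', mergeProcess]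
    simp only [ih]

theorem IsIID.mergeProcess [IsProbabilityMeasure P] {s : ℕ → Ω → ℤ} (hs : IsIID P s) : IsIID P (mergeProcess s) :=
  hs.pair.comp (g := fun q : ℤ × ℤ => join q.1 q.2) (measurable_of_countable _)

theorem IsIID.mergeProcess_iterate [IsProbabilityMeasure P] {s : ℕ → Ω → ℤ} (hs : IsIID P s) (h : ℕ) :
    IsIID P (HierMatching.mergeProcess^[h] s) := by
  induction h with
  | zero => exact hs
  | succ h ih => rw [Function.iterate_succ_apply']; exact ih.mergeProcess

theorem neg_one_le_join {a b : ℤ} (ha : -1 ≤ a) (hb : -1 ≤ b) : -1 ≤ join a b := by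
  unfold join; split_ifs <;> omega

theorem neg_one_le_mergeProcess_iterate {s : ℕ → Ω → ℤ} (hs : ∀ᵐ ω ∂P, ∀ k, -1 ≤ s k ω) (h : ℕ) :
    ∀ᵐ ω ∂P, ∀ k, -1 ≤ mergeProcess^[h] s k ω := by
  induction h with
  | zero => exact hs
  | succ h ih =>
    rw [Function.iterate_succ_apply']
    filter_upwards [ih] with ω hω k
    exact neg_one_le_join (hω _) (hω _)

theorem IsIID.integrable {s : ℕ → Ω → ℤ} (hs : IsIID P s)
    (hint : Integrable (fun ω => (s 0 ω : ℝ)) P) (k : ℕ) :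
    Integrable (fun ω => (s k ω : ℝ)) P :=
  (((hs.identDistrib k 0).comp (measurable_of_countable (fun a : ℤ => (a : ℝ)))).integrable_iff).2
    hint

theorem IsIID.integrable_mergeProcess_iterate [IsProbabilityMeasure P] {s : ℕ → Ω → ℤ} (hs : IsIID P s)
    (hint : Integrable (fun ω => (s 0 ω : ℝ)) P) (h : ℕ) :
    Integrable (fun ω => ((HierMatching.mergeProcess^[h] s 0 ω : ℤ) : ℝ)) P := by
  induction h with
  | zero => exact hint
  | succ h ih =>
    have hh := hs.mergeProcess_iterate h
    rw [Function.iterate_succ_apply']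
    set t := HierMatching.mergeProcess^[h] s with ht
    have h1 := ((hh.integrable ih 0).norm.add (hh.integrable ih 1).norm).add (integrable_const 2)
    refine h1.mono ((measurable_of_countable (fun a : ℤ => (a : ℝ))).comp
      (hh.mergeProcess.measurable 0)).aestronglyMeasurable ?_
    filter_upwards with ω
    have h2 : ((HierMatching.mergeProcess t 0 ω : ℤ) : ℝ) =
        t 0 ω + t 1 ω + if t 0 ω = -1 ∧ t 1 ω = -1 then 2 else 0 := by
      change ((join (t 0 ω) (t 1 ω) : ℤ) : ℝ) = _
      unfold join
      push_cast
      rfl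
    rw [h2]
    simp only [Pi.add_apply]
    rw [Real.norm_of_nonneg (r := ‖(t 0 ω : ℝ)‖ + ‖(t 1 ω : ℝ)‖ + 2) (by positivity)]
    refine (norm_add_le _ _).trans (add_le_add (norm_add_le _ _) ?_)
    split_ifs <;> simp

/-- The positive part of an integer, as a real number. -/
def posPart (a : ℤ) : ℝ := ((max a 0 : ℤ) : ℝ)

theorem integrable_posPart {f : Ω → ℤ} (hf : Measurable f)
    (hint : Integrable (fun ω => (f ω : ℝ)) P) : Integrable (fun ω => posPart (f ω)) P := by
  refine hint.mono ((measurable_of_countable posPart).comp hf).aestronglyMeasurable ?_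
  filter_upwards with ω
  rw [Real.norm_eq_abs, Real.norm_eq_abs, posPart, ← Int.cast_abs, ← Int.cast_abs, Int.cast_le]
  rcases le_total (f ω) 0 with h | h
  · rw [max_eq_right h]; simp
  · rw [max_eq_left h]

/-- Positive mass is lost only when a lone red meets at least one blue, and then exactly one unit.
-/
theorem posPart_join {a b : ℤ} (ha : -1 ≤ a) (hb : -1 ≤ b) :
    posPart (join a b) = posPart a + posPart b -
      (ind {-1} a * ind (Ici 1) b + ind (Ici 1) a * ind {-1} b) := by
  have hab : ∀ c : ℤ, -1 ≤ c → c = -1 ∨ c = 0 ∨ 1 ≤ c := fun c hc => by omega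
  unfold posPart join ind
  rcases hab a ha with rfl | rfl | h1 <;> rcases hab b hb with rfl | rfl | h2
  · simp
  · simp
  · have : b ≠ -1 := by omega
    have h2' : (1 : ℝ) ≤ b := by exact_mod_cast h2
    simp [h2, this]
    rw [max_eq_left (by linarith : (0 : ℝ) ≤ b)]
    ring
  · simp
  · simp
  · simp
  · have : a ≠ -1 := by omega
    have h1' : (1 : ℝ) ≤ a := by exact_mod_cast h1
    simp [h1, this]
    rw [max_eq_left (by linarith : (0 : ℝ) ≤ a)]
    ring
  · simp
  · have h3 : a ≠ -1 := by omega
    have h4 : b ≠ -1 := by omega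
    have h1' : (1 : ℝ) ≤ a := by exact_mod_cast h1
    have h2' : (1 : ℝ) ≤ b := by exact_mod_cast h2
    simp [h1, h2, h3, h4]
    rw [max_eq_left (by linarith : (0 : ℝ) ≤ a), max_eq_left (by linarith : (0 : ℝ) ≤ b),
      max_eq_left (by linarith)]

/-- The correction in `join` is 0 or 2, so parity is additive. -/
theorem ind_odd_join (a b : ℤ) : ind {c | Odd c} (join a b) =
    ind {c | Odd c} a + ind {c | Odd c} b - 2 * (ind {c | Odd c} a * ind {c | Odd c} b) := by
  have h : Odd (join a b) ↔ ¬(Odd a ↔ Odd b) := by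
    unfold join
    split_ifs <;> simp only [Int.odd_iff] <;> omega
  unfold ind indicator
  simp only [mem_ofPred_eq, h]
  by_cases ha : Odd a <;> by_cases hb : Odd b <;> simp [ha, hb] <;> norm_num

section

variable {s : ℕ → Ω → ℤ}

theorem IsIID.integral_posPart_mergeProcess [IsProbabilityMeasure P] (hs : IsIID P s)
    (hs1 : ∀ᵐ ω ∂P, ∀ k, -1 ≤ s k ω)
    (hint : Integrable (fun ω => (s 0 ω : ℝ)) P) :
    ∫ ω, posPart (HierMatching.mergeProcess s 0 ω) ∂P = 2 * ∫ ω, posPart (s 0 ω) ∂P -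
      2 * ((∫ ω, ind {-1} (s 0 ω) ∂P) * ∫ ω, ind (Ici 1) (s 0 ω) ∂P) := by
  have h1 : ∀ᵐ ω ∂P, posPart (HierMatching.mergeProcess s 0 ω) =
      posPart (s 0 ω) + posPart (s 1 ω) -
      (ind {-1} (s 0 ω) * ind (Ici 1) (s 1 ω) + ind (Ici 1) (s 0 ω) * ind {-1} (s 1 ω)) := by
    filter_upwards [hs1] with ω hω
    exact posPart_join (hω _) (hω _)
  have hp := fun k => integrable_posPart (hs.measurable k) (hs.integrable hint k)
  have hm : ∀ A B : Set ℤ, Integrable (fun ω => ind A (s 0 ω) * ind B (s 1 ω)) P := fun A B =>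
    (integrable_ind (hs.measurable 1) B).bdd_mul
      ((measurable_of_countable (ind A)).comp (hs.measurable 0)).aestronglyMeasurable
      (c := 1) (by
        filter_upwards with ω
        rw [Real.norm_of_nonneg (ind_nonneg _ _)]
        exact ind_le_one _ _)
  have hpp : Integrable (fun ω => posPart (s 0 ω) + posPart (s 1 ω)) P := (hp 0).add (hp 1)
  have hmm : Integrable (fun ω => ind {-1} (s 0 ω) * ind (Ici 1) (s 1 ω) +
      ind (Ici 1) (s 0 ω) * ind {-1} (s 1 ω)) P := (hm _ _).add (hm _ _)
  rw [integral_congr_ae h1, integral_sub hpp hmm, integral_add (hp 0) (hp 1), integral_add (hm _ _) (hm _ _), hs.integral_mul, hs.integral_mul,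
    hs.integral_comp_eq posPart 1 0]
  ring

/-- If r is the probability of an odd state, the merged one is odd with probability 2r - 2r², which
never exceeds 1/2. -/
theorem IsIID.integral_ind_odd_mergeProcess_le [IsProbabilityMeasure P] (hs : IsIID P s) :
    ∫ ω, ind {c | Odd c} (HierMatching.mergeProcess s 0 ω) ∂P ≤ 1 / 2 := by
  have h1 : ∀ ω, ind {c | Odd c} (HierMatching.mergeProcess s 0 ω) =
      ind {c | Odd c} (s 0 ω) + ind {c | Odd c} (s 1 ω) -
        2 * (ind {c | Odd c} (s 0 ω) * ind {c | Odd c} (s 1 ω)) := fun ω => ind_odd_join _ _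
  have hi := fun k => integrable_ind (P := P) (hs.measurable k) {c | Odd c}
  have hm : Integrable (fun ω => ind {c | Odd c} (s 0 ω) * ind {c | Odd c} (s 1 ω)) P :=
    (hi 1).bdd_mul (hi 0).aestronglyMeasurable (c := 1) (by
        filter_upwards with ω
        rw [Real.norm_of_nonneg (ind_nonneg _ _)]
        exact ind_le_one _ _)
  have hii : Integrable (fun ω => ind {c | Odd c} (s 0 ω) + ind {c | Odd c} (s 1 ω)) P :=
    (hi 0).add (hi 1)
  simp_rw [h1]
  rw [integral_sub hii (hm.const_mul 2), integral_add (hi 0) (hi 1),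
    integral_const_mul, hs.integral_mul, hs.integral_comp_eq _ 1 0]
  nlinarith [sq_nonneg ((∫ ω, ind {c | Odd c} (s 0 ω) ∂P) - 1 / 2)]

theorem IsIID.integral_posPart_growth [IsProbabilityMeasure P] (hs : IsIID P s)
    (hs1 : ∀ᵐ ω ∂P, ∀ k, -1 ≤ s k ω)
    (hint : Integrable (fun ω => (s 0 ω : ℝ)) P)
    (hodd : ∫ ω, ind {c | Odd c} (s 0 ω) ∂P ≤ 1 / 2) {δ : ℝ} (hδ : 0 < δ) (hδ1 : δ ≤ 1)
    (hδb : δ ≤ ∫ ω, posPart (s 0 ω) ∂P) :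
    ∫ ω, posPart (s 0 ω) ∂P + δ ^ 2 / 8 ≤
      ∫ ω, posPart (HierMatching.mergeProcess s 0 ω) ∂P := by
  have hi := fun A => integrable_ind (P := P) (hs.measurable 0) A
  have hp := integrable_posPart (hs.measurable 0) hint
  -- Integrating these three pointwise bounds gives the inequalities that `growth_arith` needs; the
  -- last one uses a/2 ≤ a - 1 for a ≥ 2.
  have hpt : ∀ a : ℤ, ind {1} a ≤ posPart a ∧ ind {-1} a + ind {1} a ≤ ind {c | Odd c} a ∧
      (posPart a - ind {1} a) / 2 ≤ posPart a - ind (Ici 1) a := fun a => by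
    unfold ind posPart
    rcases (by omega : a ≤ 0 ∨ a = 1 ∨ 2 ≤ a) with h | rfl | h
    · have h1 : a ≠ 1 := by omega
      have h2 : ¬ 1 ≤ a := by omega
      rw [max_eq_right h]
      by_cases h3 : a = -1
      · subst h3; simp
      · have : 0 ≤ ({c | Odd c} : Set ℤ).indicator (fun _ => (1 : ℝ)) a :=
          indicator_nonneg (fun _ _ => zero_le_one) _
        simpa [h1, h2, h3] using this
    · simp
    · have h1 : a ≠ 1 := by omega
      have h2 : 1 ≤ a := by omega
      have h3 : a ≠ -1 := by omega
      have h4 : (2 : ℝ) ≤ a := by exact_mod_cast h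
      have : 0 ≤ ({c | Odd c} : Set ℤ).indicator (fun _ => (1 : ℝ)) a :=
        indicator_nonneg (fun _ _ => zero_le_one) _
      rw [max_eq_left (by omega)]
      simp [h1, h2, h3, this]
      constructor <;> linarith
  have h1 : ∫ ω, ind {1} (s 0 ω) ∂P ≤ ∫ ω, posPart (s 0 ω) ∂P :=
    integral_mono (hi _) hp fun ω => (hpt _).1
  have h2 : (∫ ω, ind {-1} (s 0 ω) ∂P) + ∫ ω, ind {1} (s 0 ω) ∂P ≤
      ∫ ω, ind {c | Odd c} (s 0 ω) ∂P := by
    rw [← integral_add (hi _) (hi _)]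
    exact integral_mono ((hi _).add (hi _)) (hi _) fun ω => (hpt _).2.1
  have h3 : ((∫ ω, posPart (s 0 ω) ∂P) - ∫ ω, ind {1} (s 0 ω) ∂P) / 2 ≤
      (∫ ω, posPart (s 0 ω) ∂P) - ∫ ω, ind (Ici 1) (s 0 ω) ∂P := by
    rw [← integral_sub hp (hi _), ← integral_sub hp (hi _), ← integral_div]
    exact integral_mono ((hp.sub (hi _)).div_const 2) (hp.sub (hi _)) fun ω => (hpt _).2.2
  rw [hs.integral_posPart_mergeProcess hs1 hint]
  exact growth_arith (integral_ind_nonneg _ _) (integral_ind_nonneg _ _) (h2.trans hodd) h1 h3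
    hδ hδ1 hδb

/-- The count starts after one merge, because only then is the parity bound available. There two
states 1 already give a mean of at least ε², which serves as δ at every later level. -/
theorem IsIID.le_integral_posPart_iterate [IsProbabilityMeasure P] (hs : IsIID P s)
    (hs1 : ∀ᵐ ω ∂P, ∀ k, -1 ≤ s k ω)
    (hint : Integrable (fun ω => (s 0 ω : ℝ)) P) {ε : ℝ} (hε : 0 < ε)
    (hεs : ε ≤ ∫ ω, ind {1} (s 0 ω) ∂P) (h : ℕ) :
    ε ^ 2 + h * ((ε ^ 2) ^ 2 / 8) ≤
      ∫ ω, posPart (HierMatching.mergeProcess^[h + 1] s 0 ω) ∂P := by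
  have hε1 : ε ≤ 1 := hεs.trans (integral_ind_le_one (hs.measurable 0) _)
  induction h with
  | zero =>
    rw [Nat.cast_zero, zero_mul, add_zero, zero_add, Function.iterate_one]
    have h1 : ∫ ω, ind {1} (s 0 ω) * ind {1} (s 1 ω) ∂P ≤
        ∫ ω, posPart (HierMatching.mergeProcess s 0 ω) ∂P := by
      refine integral_mono_of_nonneg ?_ (integrable_posPart (hs.mergeProcess.measurable 0)
        (hs.integrable_mergeProcess_iterate hint 1)) ?_
      · filter_upwards with ω using mul_nonneg (ind_nonneg _ _) (ind_nonneg _ _)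
      · filter_upwards with ω
        change _ ≤ posPart (join (s 0 ω) (s 1 ω))
        by_cases h0 : s 0 ω = 1 <;> by_cases h1 : s 1 ω = 1 <;>
          simp [ind, posPart, join, h0, h1]
    rw [hs.integral_mul] at h1
    nlinarith
  | succ h ih =>
    have hh := hs.mergeProcess_iterate (h + 1)
    have hodd : ∫ ω, ind {c | Odd c} (HierMatching.mergeProcess^[h + 1] s 0 ω) ∂P ≤ 1 / 2 := by
      rw [Function.iterate_succ_apply']
      exact (hs.mergeProcess_iterate h).integral_ind_odd_mergeProcess_le
    have := hh.integral_posPart_growth (neg_one_le_mergeProcess_iterate hs1 _)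
      (hs.integrable_mergeProcess_iterate hint _) hodd (δ := ε ^ 2) (by positivity)
      (pow_le_one₀ hε.le hε1) (le_trans (by simp; positivity) ih)
    rw [Function.iterate_succ_apply']
    push_cast
    linarith

/-- From some level on, determined by a lower bound for the probability of the state `1`, the mean
state is at least `1`. -/
theorem exists_level_one_le_integral {ε : ℝ} (hε : 0 < ε) : ∃ H : ℕ,
    ∀ {Ω : Type*} [MeasurableSpace Ω] {P : Measure Ω} [IsProbabilityMeasure P] {s : ℕ → Ω → ℤ},
      IsIID P s → (∀ᵐ ω ∂P, ∀ k, -1 ≤ s k ω) → Integrable (fun ω => (s 0 ω : ℝ)) P →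
      ε ≤ ∫ ω, ind {1} (s 0 ω) ∂P →
      1 ≤ ∫ ω, ((mergeProcess^[H] s 0 ω : ℤ) : ℝ) ∂P := by
  -- After this many increments the mean positive part exceeds 2; the state is at least its positive
  -- part minus 1.
  obtain ⟨h, hh⟩ := exists_nat_gt (2 / ((ε ^ 2) ^ 2 / 8))
  refine ⟨h + 1, fun {Ω} _ {P} _ {s} hs hs1 hint hεs => ?_⟩
  rw [div_lt_iff₀ (by positivity)] at hh
  have h1 := hs.le_integral_posPart_iterate hs1 hint hε hεs h
  have hm := (hs.mergeProcess_iterate (h + 1)).measurable 0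
  have hi := hs.integrable_mergeProcess_iterate hint (h + 1)
  have h2 : ∫ ω, posPart (mergeProcess^[h + 1] s 0 ω) ∂P ≤
      ∫ ω, (((mergeProcess^[h + 1] s 0 ω : ℤ) : ℝ) + 1) ∂P := by
    refine integral_mono_ae (integrable_posPart hm hi) (hi.add (integrable_const 1)) ?_
    filter_upwards [neg_one_le_mergeProcess_iterate hs1 (h + 1)] with ω hω
    have : max (mergeProcess^[h + 1] s 0 ω) 0 ≤ mergeProcess^[h + 1] s 0 ω + 1 :=
      max_le (by omega) (by have := hω 0; omega)
    unfold posPart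
    exact_mod_cast this
  rw [integral_add hi (integrable_const 1)] at h2
  simp only [integral_const, probReal_univ, smul_eq_mul, mul_one] at h2
  have : 0 < ε ^ 2 := by positivity
  linarith

end

end

/-! ### The law of the labels at a fixed level -/

/-- The conditional probability that a cell has label `a`, given that it has `N` points. -/
noncomputable def labelWeight (p : ℝ) (a : ℤ) (N : ℕ∞) : ℝ≥0∞ :=
  if a = 1 then (if N = 1 then ENNReal.ofReal p else 0)
  else if a = -1 then (if N = 1 then ENNReal.ofReal (1 - p) else 0)
  else if a = 0 then (if N = 0 then 1 else 0)
  else if a = 2 then (if N = 0 ∨ N = 1 then 0 else 1) else 0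

/-- The number of points in a cell. -/
noncomputable def cellCount (x : ℕ → ℝ) (n k : ℤ) : ℕ∞ := {i | cell n (x i) = k}.encard

theorem cellCount_eq_zero_iff {x : ℕ → ℝ} {n k : ℤ} :
    cellCount x n k = 0 ↔ ∀ i, cell n (x i) ≠ k := by
  rw [cellCount, encard_eq_zero, eq_empty_iff_forall_notMem]; rfl

theorem cellCount_eq_one_iff {x : ℕ → ℝ} {n k : ℤ} :
    cellCount x n k = 1 ↔ ∃ i, cell n (x i) = k ∧ ∀ j, cell n (x j) = k → j = i := by
  rw [cellCount, encard_eq_one]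
  simp only [eq_singleton_iff_unique_mem]; rfl

theorem label_of_cellCount_ne_one {x : ℕ → ℝ} (blue : ℕ → Bool) {n k : ℤ}
    (h : cellCount x n k ≠ 1) : label x blue n k = if cellCount x n k = 0 then 0 else 2 := by
  rw [Ne, cellCount_eq_one_iff] at h
  simp only [label, ← cellCount_eq_zero_iff]
  rw [if_neg fun ⟨i, h1, _, h3⟩ => h ⟨i, h1, h3⟩, if_neg fun ⟨i, h1, _, h3⟩ => h ⟨i, h1, h3⟩]

theorem label_of_unique {x : ℕ → ℝ} (blue : ℕ → Bool) {n k : ℤ} {i : ℕ} (hi : cell n (x i) = k)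
    (huniq : ∀ j, cell n (x j) = k → j = i) : label x blue n k = sgn (blue i) := by
  have hs : {i | cell n (x i) = k}.Subsingleton := fun a ha b hb =>
    (huniq a ha).trans (huniq b hb).symm
  rw [← state_eq_label hs blue id]
  have hL : leftover x id n k = {i} := by
    ext j
    exact ⟨fun h => huniq j h.1, fun h => by rw [mem_singleton_iff.1 h]; exact ⟨hi, Or.inl rfl⟩⟩
  rw [state, hL, finsum_mem_singleton]

theorem iIndepFun_nat_of_fin {Ω : Type*} [MeasurableSpace Ω] {P : Measure Ω} {α : Type*}
    [MeasurableSpace α] {f : ℕ → Ω → α} (h : ∀ m, iIndepFun (fun i : Fin m => f i) P) :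
    iIndepFun f P := by
  rw [iIndepFun_iff_finset]
  intro T
  have hlt : ∀ i : T, (i : ℕ) < T.sup id + 1 := fun i =>
    Nat.lt_succ_of_le (Finset.le_sup (f := id) i.2)
  exact (h (T.sup id + 1)).precomp (g := fun i : T => ⟨i, hlt i⟩)
    (fun a b hab => Subtype.ext (by simpa using hab))

/-- Sure and impossible events do not affect the product formula. It is applied to cells without
exactly one point, whose label is fixed by the positions. -/
theorem prob_forall_of_const {Ω : Type*} [MeasurableSpace Ω] {P : Measure Ω}
    [IsProbabilityMeasure P] {ι : Type*} {E : ι → Set Ω} {J : Set ι}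
    (hJ : ∀ T : Finset ι, (∀ j ∈ T, j ∈ J) → P (⋂ j ∈ T, E j) = ∏ j ∈ T, P (E j))
    (hc : ∀ j ∉ J, E j = univ ∨ E j = ∅) (T : Finset ι) :
    P (⋂ j ∈ T, E j) = ∏ j ∈ T, P (E j) := by
  classical
  by_cases h : ∃ j ∈ T, E j = ∅
  · obtain ⟨j, hj, hE⟩ := h
    rw [Finset.prod_eq_zero hj (by rw [hE, measure_empty]), ← nonpos_iff_eq_zero,
      ← measure_empty (μ := P)]
    exact measure_mono ((biInter_subset_of_mem (t := E) (Finset.mem_coe.2 hj)).trans hE.le)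
  · push Not at h
    have hu : ∀ j ∈ T, j ∉ J → E j = univ := fun j hj hjJ =>
      (hc j hjJ).resolve_right (h j hj).ne_empty
    have h1 := hJ (T.filter (· ∈ J)) fun j hj => (Finset.mem_filter.1 hj).2
    rw [Finset.prod_filter] at h1
    have h2 : ⋂ j ∈ T.filter (· ∈ J), E j = ⋂ j ∈ T, E j := by
      ext ω
      simp only [mem_iInter, Finset.mem_filter]
      exact ⟨fun h j hj => by
        by_cases hjJ : j ∈ J
        · exact h j ⟨hj, hjJ⟩
        · rw [hu j hj hjJ]; trivial, fun h j hj => h j hj.1⟩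
    rw [← h2, h1]
    refine Finset.prod_congr rfl fun j hj => ?_
    split_ifs with hjJ
    · rfl
    · rw [hu j hj hjJ, measure_univ]

section

variable {Ω : Type*} [MeasurableSpace Ω] {P : Measure Ω}
  {lam p : ℝ} {X : ℕ → Ω → ℝ} {blue : ℕ → Ω → Bool}

theorem IsColouredPoissonProcess.prob_sgn [IsProbabilityMeasure P]
    (h : IsColouredPoissonProcess P lam p X blue)
    (hp : 0 ≤ p) (i : ℕ) (a : ℤ) :
    P {ω | sgn (blue i ω) = a} = labelWeight p a 1 := by
  have hb := h.prob_blue i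
  have hr : P {ω | blue i ω = false} = ENNReal.ofReal (1 - p) := by
    have hm : MeasurableSet {ω | blue i ω = true} :=
      h.measurable_blue i (measurableSet_singleton true)
    have : {ω | blue i ω = false} = {ω | blue i ω = true}ᶜ := by ext; simp
    rw [this, prob_compl_eq_one_sub hm, hb, ENNReal.ofReal_sub _ hp, ENNReal.ofReal_one]
  unfold labelWeight
  by_cases h1 : a = 1
  · subst h1
    rw [if_pos rfl, if_pos rfl, ← hb]
    congr 1; ext ω; cases hω : blue i ω <;> simp [sgn, hω]
  by_cases h2 : a = -1
  · subst h2
    rw [if_neg h1, if_pos rfl, if_pos rfl, ← hr]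
    congr 1; ext ω; cases hω : blue i ω <;> simp [sgn, hω]
  · have : {ω | sgn (blue i ω) = a} = ∅ := by
      ext ω
      simp only [mem_ofPred_eq, mem_empty_iff_false, iff_false]
      cases blue i ω <;> simp [sgn] <;> omega
    rw [this, measure_empty, if_neg h1, if_neg h2]
    simp

/-- Given the positions, the labels are independent. -/
theorem IsColouredPoissonProcess.prob_label_fixed [IsProbabilityMeasure P]
    (h : IsColouredPoissonProcess P lam p X blue)
    (hp : 0 ≤ p) (x : ℕ → ℝ) (n : ℤ) (T : Finset ℕ) (a : ℕ → ℤ) :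
    P {ω | ∀ j ∈ T, label x (fun i => blue i ω) n j = a j} =
      ∏ j ∈ T, labelWeight p (a j) (cellCount x n j) := by
  set E : ℕ → Set Ω := fun j => {ω | label x (fun i => blue i ω) n j = a j} with hE
  set J : Set ℕ := {j | cellCount x n j = 1} with hJ
  have hex : ∀ j : ℕ, ∃ i, j ∈ J → cell n (x i) = j ∧ ∀ i', cell n (x i') = j → i' = i := fun j => by
    by_cases hj : j ∈ J
    · obtain ⟨i, hi⟩ := cellCount_eq_one_iff.1 hj
      exact ⟨i, fun _ => hi⟩
    · exact ⟨0, fun h => absurd h hj⟩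
  choose idx hidx using hex
  have hEJ : ∀ j ∈ J, E j = {ω | sgn (blue (idx j) ω) = a j} := fun j hj => by
    ext ω
    simp only [hE, mem_ofPred_eq]
    rw [label_of_unique _ (hidx j hj).1 (hidx j hj).2]
  have hEc : ∀ j ∉ J, E j = {ω | (if cellCount x n j = 0 then 0 else 2) = a j} := fun j hj => by
    ext ω
    simp only [hE, mem_ofPred_eq]
    rw [label_of_cellCount_ne_one _ hj]
  have hinj : Set.InjOn idx J := fun j hj k hk hjk => by
    have h1 := (hidx j hj).1
    have h2 := (hidx k hk).1
    rw [hjk, h2] at h1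
    exact_mod_cast h1.symm
  have h1 := prob_forall_of_const (P := P) (E := E) (J := J) (fun T hT => ?_) (fun j hj => ?_) T
  · have h2 : {ω | ∀ j ∈ T, label x (fun i => blue i ω) n j = a j} = ⋂ j ∈ T, E j := by
      ext; simp [hE]
    rw [h2, h1]
    refine Finset.prod_congr rfl fun j _ => ?_
    by_cases hj : j ∈ J
    · rw [hEJ j hj, h.prob_sgn hp, show cellCount x n j = 1 from hj]
    · have hj' : cellCount x n j ≠ 1 := hj
      rw [hEc j hj]
      unfold labelWeight
      by_cases h0 : cellCount x n j = 0
      · simp only [h0, if_true, zero_ne_one, if_false, true_or]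
        by_cases ha : a j = 0
        · simp [ha]
        · simp [ha, Ne.symm ha]
      · simp only [h0, hj', if_false, or_false]
        by_cases ha : a j = 2
        · simp [ha]
        · simp [ha, Ne.symm ha]
  -- Distinct one-point cells have distinct points, whose colours are independent.
  · have hind : iIndepFun (fun j : J => blue (idx j)) P :=
      h.indep_blue.precomp (g := fun j : J => idx j) fun j k hjk =>
        Subtype.ext (hinj j.2 k.2 hjk)
    classical
    have h3 := hind.measure_inter_preimage_eq_mul (T.subtype (· ∈ J))
      (sets := fun j => {b | sgn b = a j}) (fun _ _ => MeasurableSet.of_discrete)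
    have h4 : ∏ j ∈ T.subtype (· ∈ J), P (blue (idx j) ⁻¹' {b | sgn b = a j}) =
        ∏ j ∈ T, P (E j) := by
      rw [← Finset.prod_subtype_of_mem (fun j => P (E j)) hT]
      refine Finset.prod_congr rfl fun j _ => ?_
      rw [hEJ j j.2]; rfl
    rw [← h4, ← h3]
    congr 1
    ext ω
    simp only [mem_iInter, Finset.mem_subtype, mem_preimage, mem_ofPred_eq, Subtype.forall]
    exact forall_congr' fun j => ⟨fun hh hj hjT => by have := hh hjT; rwa [hEJ j hj] at this,
      fun hh hjT => by rw [hEJ j (hT j hjT)]; exact hh (hT j hjT) hjT⟩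
  · rw [hEc j hj]
    by_cases hc : (if cellCount x n j = 0 then 0 else 2) = a j
    · left; ext; simp [hc]
    · right; ext; simp [hc]

theorem measurableSet_cell_eq (n k : ℤ) : MeasurableSet {y : ℝ | cell n y = k} := by
  have : {y : ℝ | cell n y = k} = Ico (k * (2 : ℝ) ^ n) ((k + 1) * 2 ^ n) := by
    ext y; exact cell_eq_iff_mem_Ico n y k
  rw [this]; exact measurableSet_Ico

theorem measurableSet_exists {α : Type*} [MeasurableSpace α] {q : ℕ → α → Prop}
    (hq : ∀ i, MeasurableSet {x | q i x}) : MeasurableSet {x | ∃ i, q i x} := by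
  rw [ofPred_exists]; exact MeasurableSet.iUnion hq

theorem measurableSet_forall {α : Type*} [MeasurableSpace α] {q : ℕ → α → Prop}
    (hq : ∀ i, MeasurableSet {x | q i x}) : MeasurableSet {x | ∀ i, q i x} := by
  rw [ofPred_forall]; exact MeasurableSet.iInter hq

theorem measurableSet_imp {α : Type*} [MeasurableSpace α] {q : α → Prop}
    (hq : MeasurableSet {x | q x}) (r : Prop) : MeasurableSet {x | q x → r} := by
  simp only [imp_iff_not_or]
  exact hq.compl.union (MeasurableSet.const r)

theorem measurable_label (n k : ℤ) :
    Measurable fun q : (ℕ → ℝ) × (ℕ → Bool) => label q.1 q.2 n k := by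
  have hc : ∀ i, MeasurableSet {q : (ℕ → ℝ) × (ℕ → Bool) | cell n (q.1 i) = k} := fun i =>
    (measurableSet_cell_eq n k).preimage ((measurable_pi_apply i).comp measurable_fst)
  have hb : ∀ i (b : Bool), MeasurableSet {q : (ℕ → ℝ) × (ℕ → Bool) | q.2 i = b} := fun i b =>
    (measurableSet_singleton b).preimage ((measurable_pi_apply i).comp measurable_snd)
  have h1 : ∀ b : Bool, MeasurableSet {q : (ℕ → ℝ) × (ℕ → Bool) | ∃ i, cell n (q.1 i) = k ∧
      q.2 i = b ∧ ∀ j, cell n (q.1 j) = k → j = i} := fun b => by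
    refine measurableSet_exists fun i => (hc i).inter ((hb i b).inter ?_)
    exact measurableSet_forall fun j => measurableSet_imp (hc j) _
  have h0 : MeasurableSet {q : (ℕ → ℝ) × (ℕ → Bool) | ∀ i, cell n (q.1 i) ≠ k} :=
    measurableSet_forall fun i => (hc i).compl
  exact Measurable.ite (h1 true) measurable_const (Measurable.ite (h1 false) measurable_const
    (Measurable.ite h0 measurable_const measurable_const))

theorem measurable_labelWeight (p : ℝ) (n k a : ℤ) :
    Measurable fun x : ℕ → ℝ => labelWeight p a (cellCount x n k) := by
  have hc : ∀ i, MeasurableSet {x : ℕ → ℝ | cell n (x i) = k} := fun i =>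
    (measurableSet_cell_eq n k).preimage (measurable_pi_apply i)
  have h0 : MeasurableSet {x : ℕ → ℝ | cellCount x n k = 0} := by
    simp_rw [cellCount_eq_zero_iff]
    exact measurableSet_forall fun i => (hc i).compl
  have h1 : MeasurableSet {x : ℕ → ℝ | cellCount x n k = 1} := by
    simp_rw [cellCount_eq_one_iff]
    exact measurableSet_exists fun i => (hc i).inter
      (measurableSet_forall fun j => measurableSet_imp (hc j) _)
  unfold labelWeight
  split_ifs
  · exact Measurable.ite h1 measurable_const measurable_const
  · exact Measurable.ite h1 measurable_const measurable_const
  · exact Measurable.ite h0 measurable_const measurable_const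
  · exact Measurable.ite (h0.union h1) measurable_const measurable_const
  · exact measurable_const

/-- The law of the number of points in a cell. -/
noncomputable def cellLaw (lam : ℝ) (n : ℤ) : Measure ℕ∞ :=
  (poissonMeasure (lam.toNNReal * (ENNReal.ofReal (2 ^ n)).toNNReal)).map ((↑) : ℕ → ℕ∞)

theorem IsPoissonProcess.hasLaw_cellCount (h : IsPoissonProcess P lam X) (n : ℤ) (j : ℕ) :
    HasLaw (fun ω => cellCount (fun i => X i ω) n j) (cellLaw lam n) P := by
  have h1 := h.law_count (Ico ((j : ℤ) * (2 : ℝ) ^ n) (((j : ℤ) + 1) * 2 ^ n)) measurableSet_Ico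
    (fun y hy => le_trans (by positivity) hy.1) (by rw [Real.volume_Ico]; exact ENNReal.ofReal_ne_top)
  rw [Real.volume_Ico, ← sub_mul, add_sub_cancel_left, one_mul] at h1
  simp_rw [← cell_eq_iff_mem_Ico] at h1
  exact h1

theorem IsPoissonProcess.iIndepFun_cellCount (h : IsPoissonProcess P lam X) (n : ℤ) :
    iIndepFun (fun (j : ℕ) ω => cellCount (fun i => X i ω) n j) P := by
  refine iIndepFun_nat_of_fin fun m => ?_
  have h1 := h.indep_count m (fun j => Ico (((j : ℕ) : ℤ) * (2 : ℝ) ^ n) ((((j : ℕ) : ℤ) + 1) * 2 ^ n))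
    (fun j => ⟨measurableSet_Ico, fun y hy => le_trans (by positivity) hy.1,
      by rw [Real.volume_Ico]; exact ENNReal.ofReal_ne_top⟩)
    (fun j k hjk => Set.disjoint_left.2 fun y hy hy' => hjk ?_)
  · simp_rw [← cell_eq_iff_mem_Ico] at h1
    exact h1
  · rw [← cell_eq_iff_mem_Ico] at hy hy'
    rw [hy] at hy'
    exact Fin.ext (by exact_mod_cast hy')

/-- Integrate over the colours for fixed positions; the resulting product depends only on the counts
of disjoint cells, which are independent. -/
theorem IsColouredPoissonProcess.prob_labels [IsProbabilityMeasure P]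
    (h : IsColouredPoissonProcess P lam p X blue)
    (hp : 0 ≤ p) (n : ℤ) (T : Finset ℕ) (a : ℕ → ℤ) :
    P {ω | ∀ j ∈ T, label (fun i => X i ω) (fun i => blue i ω) n j = a j} =
      ∏ j ∈ T, ∫⁻ N, labelWeight p (a j) N ∂(cellLaw lam n) := by
  have hX : Measurable fun ω i => X i ω := measurable_pi_lambda _ h.poisson.measurable
  have hb : Measurable fun ω i => blue i ω := measurable_pi_lambda _ h.measurable_blue
  set S : Set ((ℕ → ℝ) × (ℕ → Bool)) := {q | ∀ j ∈ T, label q.1 q.2 n j = a j} with hS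
  have hSm : MeasurableSet S := by
    have : S = ⋂ j ∈ T, (fun q : (ℕ → ℝ) × (ℕ → Bool) => label q.1 q.2 n j) ⁻¹' {a j} := by
      ext; simp [hS]
    rw [this]
    exact Finset.measurableSet_biInter _ fun j _ => measurable_label n j (measurableSet_singleton _)
  have h1 : P {ω | ∀ j ∈ T, label (fun i => X i ω) (fun i => blue i ω) n j = a j} =
      P.map (fun ω => ((fun i => X i ω), (fun i => blue i ω))) S :=
    (Measure.map_apply (hX.prodMk hb) hSm).symm
  have : IsProbabilityMeasure (P.map fun ω i => blue i ω) :=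
    Measure.isProbabilityMeasure_map hb.aemeasurable
  rw [h1, (indepFun_iff_map_prod_eq_prod_map_map hX.aemeasurable hb.aemeasurable).1
    h.indep_points_blue, Measure.prod_apply hSm]
  have h2 : ∀ x : ℕ → ℝ, (P.map fun ω i => blue i ω) (Prod.mk x ⁻¹' S) =
      ∏ j ∈ T, labelWeight p (a j) (cellCount x n j) := fun x => by
    rw [Measure.map_apply hb (measurable_prodMk_left hSm)]
    exact h.prob_label_fixed hp x n T a
  simp_rw [h2]
  rw [lintegral_map (Finset.measurable_prod T fun (j : ℕ) _ => measurable_labelWeight p n j (a j)) hX]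
  rw [lintegral_prod_eq_prod_lintegral_of_indepFun T
    (fun j ω => labelWeight p (a j) (cellCount (fun i => X i ω) n j))
    ((h.poisson.iIndepFun_cellCount n).comp (fun j => labelWeight p (a j))
      fun _ => measurable_of_countable _)
    fun j => (measurable_labelWeight p n j (a j)).comp hX]
  exact Finset.prod_congr rfl fun j _ =>
    (h.poisson.hasLaw_cellCount n j).lintegral_comp (measurable_of_countable _).aemeasurable

theorem IsColouredPoissonProcess.prob_label [IsProbabilityMeasure P]
    (h : IsColouredPoissonProcess P lam p X blue)
    (hp : 0 ≤ p) (n : ℤ) (j : ℕ) (a : ℤ) :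
    P {ω | label (fun i => X i ω) (fun i => blue i ω) n j = a} =
      ∫⁻ N, labelWeight p a N ∂(cellLaw lam n) := by
  simpa using h.prob_labels hp n {j} fun _ => a

theorem IsColouredPoissonProcess.isIID_label [IsProbabilityMeasure P]
    (h : IsColouredPoissonProcess P lam p X blue)
    (hp : 0 ≤ p) (n : ℤ) :
    IsIID P (fun (j : ℕ) ω => label (fun i => X i ω) (fun i => blue i ω) n j) := by
  have hm : ∀ j : ℕ, Measurable fun ω => label (fun i => X i ω) (fun i => blue i ω) n j := fun j =>
    (measurable_label n j).comp ((measurable_pi_lambda _ h.poisson.measurable).prodMk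
      (measurable_pi_lambda _ h.measurable_blue))
  refine ⟨hm, iIndepFun_of_singletons hm fun T a => ?_, fun k => Measure.ext_of_singleton fun a => ?_⟩
  · rw [h.prob_labels hp]
    exact Finset.prod_congr rfl fun j _ => (h.prob_label hp n j (a j)).symm
  · rw [Measure.map_apply (hm k) (measurableSet_singleton a),
      Measure.map_apply (hm 0) (measurableSet_singleton a)]
    exact (h.prob_label hp n k a).trans (h.prob_label hp n 0 a).symm

/-- Keeping a single atom of the Poisson law is enough to show that a label has positive
probability. -/
theorem mul_cellLaw_le_lintegral (p lam : ℝ) (n a : ℤ) (N : ℕ) :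
    labelWeight p a N * poissonMeasure (lam.toNNReal * (ENNReal.ofReal (2 ^ n)).toNNReal) {N} ≤
      ∫⁻ N, labelWeight p a N ∂(cellLaw lam n) := by
  rw [cellLaw, lintegral_map (measurable_of_countable _) measurable_from_top]
  refine le_trans ?_ (setLIntegral_le_lintegral {N} _)
  rw [lintegral_singleton]

end

/-! ### Almost sure properties of the process and the density bound -/

section

variable {Ω : Type*} [MeasurableSpace Ω] {P : Measure Ω}
  {lam p : ℝ} {X : ℕ → Ω → ℝ} {blue : ℕ → Ω → Bool}

theorem IsPoissonProcess.ae_finite_cell (h : IsPoissonProcess P lam X) :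
    ∀ᵐ ω ∂P, ∀ n k, {i | cell n (X i ω) = k}.Finite := by
  have h1 : ∀ᵐ ω ∂P, ∀ (n : ℤ) (j : ℕ), cellCount (fun i => X i ω) n j ≠ ⊤ := by
    refine ae_all_iff.2 fun n => ae_all_iff.2 fun j => ?_
    refine ((h.hasLaw_cellCount n j).ae_iff (p := fun N => N ≠ ⊤) (measurable_of_countable _)).2 ?_
    rw [cellLaw, ae_map_iff measurable_from_top.aemeasurable MeasurableSet.of_discrete]
    exact Eventually.of_forall fun N => ENat.natCast_ne_top N
  filter_upwards [h1, h.nonneg] with ω hω h0 n k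
  rcases lt_or_ge k 0 with hk | hk
  · have : {i | cell n (X i ω) = k} = ∅ := eq_empty_of_forall_notMem fun i hi => by
      have h2 := cell_nonneg n (h0 i)
      have h3 : cell n (X i ω) = k := hi
      omega
    rw [this]; exact finite_empty
  · obtain ⟨j, rfl⟩ := Int.eq_ofNat_of_zero_le hk
    exact encard_ne_top_iff.1 (hω n j)

theorem lintegral_labelWeight_pos (hlam : 0 < lam) (hp0 : 0 < p) (hp1 : p < 1) (n : ℤ) {a : ℤ}
    (ha : a = 1 ∨ a = -1 ∨ a = 0) : 0 < ∫⁻ N, labelWeight p a N ∂(cellLaw lam n) := by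
  have hr : 0 < lam.toNNReal * (ENNReal.ofReal (2 ^ n)).toNNReal := by
    refine mul_pos (Real.toNNReal_pos.2 hlam) (ENNReal.toNNReal_pos ?_ ENNReal.ofReal_ne_top)
    exact (ENNReal.ofReal_pos.2 (by positivity)).ne'
  have hpos : ∀ N : ℕ,
      poissonMeasure (lam.toNNReal * (ENNReal.ofReal (2 ^ n)).toNNReal) {N} ≠ 0 := fun N h0 => by
    have := poissonMeasure_real_singleton_pos N hr
    rw [measureReal_def, h0] at this
    simp at this
  rcases ha with rfl | rfl | rfl
  · refine lt_of_lt_of_le (pos_iff_ne_zero.2 (mul_ne_zero ?_ (hpos 1)))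
      (mul_cellLaw_le_lintegral p lam n 1 1)
    simp [labelWeight, hp0]
  · refine lt_of_lt_of_le (pos_iff_ne_zero.2 (mul_ne_zero ?_ (hpos 1)))
      (mul_cellLaw_le_lintegral p lam n (-1) 1)
    simp [labelWeight, hp1]
  · refine lt_of_lt_of_le (pos_iff_ne_zero.2 (mul_ne_zero ?_ (hpos 0)))
      (mul_cellLaw_le_lintegral p lam n 0 0)
    simp [labelWeight]

theorem IsColouredPoissonProcess.ae_infinite_gadgets [IsProbabilityMeasure P]
    (h : IsColouredPoissonProcess P lam p X blue) (hlam : 0 < lam) (hp0 : 0 < p) (hp1 : p < 1) :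
    ∀ᵐ ω ∂P, {k | IsGadget (fun i => X i ω) (fun i => blue i ω) k}.Infinite := by
  set l : ℕ → Ω → ℤ := fun j ω => label (fun i => X i ω) (fun i => blue i ω) 0 j with hl
  have hiid : IsIID P l := h.isIID_label hp0.le 0
  have hev : {ω | (((l (2 * (2 * 0)) ω, l (2 * (2 * 0) + 1) ω),
      (l (2 * (2 * 0 + 1)) ω, l (2 * (2 * 0 + 1) + 1) ω)) : (ℤ × ℤ) × (ℤ × ℤ)) ∈
      ({((-1, 0), (1, 1))} : Set ((ℤ × ℤ) × (ℤ × ℤ)))} =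
      {ω | ∀ j ∈ Finset.range 4, l j ω = if j = 0 then -1 else if j = 1 then 0 else 1} := by
    ext ω
    simp only [mem_ofPred_eq, mem_singleton_iff, Prod.mk.injEq, Finset.mem_range]
    constructor
    · rintro ⟨⟨h0, h1⟩, h2, h3⟩ j hj
      interval_cases j
      · exact h0
      · exact h1
      · exact h2
      · exact h3
    · intro h
      exact ⟨⟨h 0 (by norm_num), h 1 (by norm_num)⟩, h 2 (by norm_num), h 3 (by norm_num)⟩
  have hpos := h.prob_labels hp0.le 0 (Finset.range 4)
    (fun j => if j = 0 then -1 else if j = 1 then 0 else 1)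
  -- Pairing twice groups the unit cells into independent blocks of four, the candidate gadgets.
  have := hiid.pair.pair.infinite_setOf_mem (A := {((-1, 0), (1, 1))}) (measurableSet_singleton _) (by
    rw [hev]
    refine lt_of_lt_of_eq ?_ hpos.symm
    refine pos_iff_ne_zero.2 (Finset.prod_ne_zero_iff.2 fun j _ =>
      (lintegral_labelWeight_pos hlam hp0 hp1 0 ?_).ne')
    split_ifs <;> simp)
  filter_upwards [this] with ω hω
  refine hω.mono fun k hk => ?_
  simp only [mem_ofPred_eq, mem_singleton_iff, Prod.mk.injEq, hl] at hk
  obtain ⟨⟨h0, h1⟩, h2, h3⟩ := hk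
  push_cast at h0 h1 h2 h3
  refine ⟨?_, ?_, ?_, ?_⟩
  · rw [← h0]; congr 1; ring
  · rw [← h1]; congr 1; ring
  · rw [← h2]; congr 1; ring
  · rw [← h3]; congr 1; ring

theorem abs_state_le {V : Type*} {x : V → ℝ} {b : V → Bool} {M : V → V} (hx : ∀ i, 0 ≤ x i)
    (hfin : ∀ n k, {i | cell n (x i) = k}.Finite) (hM : M ∈ stableMatchings x b) (n k : ℤ) :
    |state x b M n k| ≤ ({i | cell n (x i) = k}.ncard : ℤ) := by
  have hsub : leftover x M n k ⊆ {i | cell n (x i) = k} := fun i hi => hi.1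
  have hle := ncard_le_ncard hsub (hfin n k)
  rcases state_cases hx hfin hM n k with ⟨r, -, hL, h⟩ | ⟨-, h⟩
  · rw [hL, ncard_singleton] at hle
    rw [h, abs_neg, abs_one]
    exact_mod_cast hle
  · rw [h, Nat.abs_cast]
    exact_mod_cast hle

theorem IsPoissonProcess.integrable_cellCount (h : IsPoissonProcess P lam X) (n : ℤ) (j : ℕ) :
    Integrable (fun ω => ((cellCount (fun i => X i ω) n j).toNat : ℝ)) P := by
  have hlaw := h.hasLaw_cellCount n j
  have h1 : Integrable (fun N : ℕ∞ => (N.toNat : ℝ)) (cellLaw lam n) := by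
    rw [cellLaw, integrable_map_measure (measurable_of_countable _).aestronglyMeasurable
      measurable_from_top.aemeasurable, integrable_poissonMeasure_iff]
    set r : ℝ≥0 := lam.toNNReal * (ENNReal.ofReal (2 ^ n)).toNNReal
    have h2 : Summable fun N : ℕ => Real.exp (-r) * (r * ((r : ℝ) ^ N / N.factorial)) :=
      ((Real.summable_pow_div_factorial r).mul_left _).mul_left _
    refine (summable_nat_add_iff 1).1 (h2.congr fun N => ?_)
    simp only [Function.comp, ENat.toNat_natCast, Nat.factorial_succ]
    rw [Real.norm_of_nonneg (by positivity)]
    push_cast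
    field_simp
    ring
  rw [← hlaw.map_eq] at h1
  exact h1.comp_aemeasurable hlaw.aemeasurable

/-- A lower bound for the probability that a unit interval has state `1`. -/
noncomputable def unitBlueProb (lam p : ℝ) : ℝ :=
  (∫⁻ N, labelWeight p 1 N ∂(cellLaw lam 0)).toReal

/-- States are a priori attached to a matching. Merged labels do not involve one and eventually
equal the state, so their limit is a measurable i.i.d. process common to all stable matchings. -/
theorem IsColouredPoissonProcess.exists_state_process [IsProbabilityMeasure P]
    (h : IsColouredPoissonProcess P lam p X blue) (hp0 : 0 < p) :
    ∃ S : ℕ → Ω → ℤ, IsIID P S ∧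
      (∀ᵐ ω ∂P, ∀ M ∈ stableMatchings (fun i => X i ω) (fun i => blue i ω), ∀ k : ℕ,
        state (fun i => X i ω) (fun i => blue i ω) M 0 k = S k ω) ∧
      (∀ᵐ ω ∂P, ∀ k, -1 ≤ S k ω) ∧ Integrable (fun ω => (S 0 ω : ℝ)) P ∧
      unitBlueProb lam p ≤ ∫ ω, ind {1} (S 0 ω) ∂P := by
  let l : ℤ → ℕ → Ω → ℤ := fun n j ω => label (fun i => X i ω) (fun i => blue i ω) n j
  have hl : ∀ n, IsIID P (l n) := fun n => h.isIID_label hp0.le n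
  let s : ℕ → ℕ → Ω → ℤ := fun m => mergeProcess^[m] (l (-m))
  have hs : ∀ m, IsIID P (s m) := fun m => (hl _).mergeProcess_iterate m
  -- The limsup is measurable without any choice of a matching, and a.s. is an eventual value.
  let S : ℕ → Ω → ℤ := fun k ω => limsup (fun m => s m k ω) atTop
  have hSm : ∀ k, Measurable (S k) := fun k => Measurable.limsup fun m => (hs m).measurable k
  have hev : ∀ᵐ ω ∂P, ∀ M ∈ stableMatchings (fun i => X i ω) (fun i => blue i ω), ∀ k : ℕ,
      ∀ᶠ m in atTop, s m k ω = state (fun i => X i ω) (fun i => blue i ω) M 0 k := by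
    filter_upwards [h.poisson.nonneg, h.poisson.injective, h.poisson.ae_finite_cell]
      with ω h0 hinj hfin M hM k
    filter_upwards [eventually_merge_label_eq_state h0 hinj hfin hM k] with m hm
    rw [← hm]
    exact mergeProcess_iterate _ _ _ _
  have hstate : ∀ᵐ ω ∂P, ∀ M ∈ stableMatchings (fun i => X i ω) (fun i => blue i ω), ∀ k : ℕ,
      state (fun i => X i ω) (fun i => blue i ω) M 0 k = S k ω := by
    filter_upwards [hev] with ω hω M hM k
    exact ((limsup_congr (hω M hM k)).trans (limsup_const _)).symm
  have hne : ∀ᵐ ω ∂P, (stableMatchings (fun i => X i ω) (fun i => blue i ω)).Nonempty := by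
    filter_upwards [h.poisson.nonneg, h.poisson.ae_finite_cell] with ω h0 hfin
    exact exists_mem_stableMatchings h0 hfin _
  have hlim : ∀ᵐ ω ∂P, ∀ k, ∀ᶠ m in atTop, s m k ω = S k ω := by
    filter_upwards [hev, hstate, hne] with ω h1 h2 ⟨M, hM⟩ k
    rw [← h2 M hM k]
    exact h1 M hM k
  have hS : IsIID P S := IsIID.of_eventually_eq hs hSm hlim
  refine ⟨S, hS, hstate, ?_, ?_, ?_⟩
  · filter_upwards [h.poisson.nonneg, h.poisson.ae_finite_cell, hstate, hne]
      with ω h0 hfin h2 ⟨M, hM⟩ k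
    rw [← h2 M hM k]
    exact neg_one_le_state h0 hfin hM 0 k
  · refine (h.poisson.integrable_cellCount 0 0).mono
      ((measurable_of_countable (fun a : ℤ => (a : ℝ))).comp (hSm 0)).aestronglyMeasurable ?_
    filter_upwards [h.poisson.nonneg, h.poisson.ae_finite_cell, hstate, hne]
      with ω h0 hfin h2 ⟨M, hM⟩
    rw [← h2 M hM 0, Real.norm_eq_abs, Real.norm_of_nonneg (by positivity)]
    exact_mod_cast abs_state_le h0 hfin hM 0 (0 : ℕ)
  · have h1 : ∫ ω, ind {1} (l 0 0 ω) ∂P ≤ ∫ ω, ind {1} (S 0 ω) ∂P := by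
      refine integral_mono_ae (integrable_ind ((hl 0).measurable 0) _) (integrable_ind (hSm 0) _) ?_
      filter_upwards [hstate, hne] with ω h2 ⟨M, hM⟩
      by_cases hl1 : l 0 0 ω = 1
      · obtain ⟨i, -, -, huniq⟩ := exists_unique_of_label_eq_one hl1
        have := state_eq_label (M := M) (fun a ha b hb => (huniq a ha).trans (huniq b hb).symm)
          (fun i => blue i ω)
        rw [← h2 M hM 0, this]
      · rw [show ind {1} (l 0 0 ω) = 0 by simp [ind, hl1]]
        exact ind_nonneg _ _
    refine le_trans ?_ h1
    have h2 : ∀ ω, ind {1} (l 0 0 ω) = (l 0 0 ⁻¹' {1}).indicator (fun _ => (1 : ℝ)) ω :=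
      fun ω => by simp [ind, indicator]
    simp_rw [h2]
    rw [integral_indicator_const _ ((hl 0).measurable 0 (measurableSet_singleton 1)), smul_eq_mul,
      mul_one, measureReal_def]
    rw [unitBlueProb, ← h.prob_label hp0.le 0 0 1]
    exact le_rfl

theorem unitBlueProb_pos (hlam : 0 < lam) (hp0 : 0 < p) (hp1 : p < 1) :
    0 < unitBlueProb lam p := by
  have : IsProbabilityMeasure (cellLaw lam 0) :=
    Measure.isProbabilityMeasure_map measurable_from_top.aemeasurable
  have hle : ∀ N, labelWeight p 1 N ≤ 1 := fun N => by
    simp only [labelWeight, if_true]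
    split_ifs
    · exact ENNReal.ofReal_le_one.2 hp1.le
    · exact zero_le_one
  refine ENNReal.toReal_pos (lintegral_labelWeight_pos hlam hp0 hp1 0 (Or.inl rfl)).ne' ?_
  refine ((lintegral_mono hle).trans_lt ?_).ne
  simp

/-- The sum over [n, 2n) divided by n is twice the average up to 2n minus the average up to n, so it
also tends to μ. -/
theorem eventually_sums_of_tendsto_average {t : ℕ → ℝ} {μ : ℝ} (hμ : 1 ≤ μ)
    (ht : Tendsto (fun n : ℕ => (∑ i ∈ Finset.range n, t i) / n) atTop (nhds μ)) :
    ∀ᶠ n : ℕ in atTop, (n : ℝ) / 2 ≤ ∑ i ∈ Finset.range n, t i ∧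
      0 < ∑ i ∈ Finset.Ico n (2 * n), t i := by
  have h2 : Tendsto (fun n : ℕ => 2 * n) atTop atTop :=
    tendsto_id.const_mul_atTop' (by norm_num)
  have h3 := (ht.comp h2).const_mul 2 |>.sub ht
  filter_upwards [ht.eventually (lt_mem_nhds (show 1 / 2 < μ by linarith)),
    h3.eventually (lt_mem_nhds (show 0 < 2 * μ - μ by linarith)), eventually_gt_atTop 0]
    with n ha hb hn
  have hn' : (0 : ℝ) < n := by exact_mod_cast hn
  constructor
  · rw [lt_div_iff₀ hn'] at ha
    linarith
  · rw [Finset.sum_Ico_eq_sub _ (by omega)]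
    simp only [Function.comp] at hb
    push_cast at hb
    have : 2 * ((∑ i ∈ Finset.range (2 * n), t i) / (2 * n)) - (∑ i ∈ Finset.range n, t i) / n =
        (∑ i ∈ Finset.range (2 * n), t i - ∑ i ∈ Finset.range n, t i) / n := by
      field_simp
    rw [this] at hb
    exact (div_pos_iff_of_pos_right hn').1 hb

/-- If the block averages of the states at level `H` tend to a limit that is at least one, then
every stable matching has a positive density of unmatched blue points. -/
theorem eventually_le_ncard_unmatchedBlue {x : ℕ → ℝ} {b : ℕ → Bool} (hx : ∀ i, 0 ≤ x i)
    (hfin : ∀ n k, {i | cell n (x i) = k}.Finite) {t : ℕ → ℤ} {H : ℕ} {μ : ℝ} (hμ : 1 ≤ μ)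
    (hstate : ∀ M ∈ stableMatchings x b, ∀ k : ℕ, state x b M H k = t k)
    (ht : Tendsto (fun n : ℕ => (∑ i ∈ Finset.range n, (t i : ℝ)) / n) atTop (nhds μ)) :
    ∀ᶠ R : ℝ in atTop, ∀ M ∈ stableMatchings x b,
      {n ∈ unmatchedBlue b M | x n ∈ Icc 0 R}.Finite ∧
      1 / 2 ^ (H + 2) * R ≤ ({n ∈ unmatchedBlue b M | x n ∈ Icc 0 R}.ncard : ℝ) := by
  obtain ⟨J, hJ⟩ := eventually_atTop.1 ((tendsto_pow_atTop_atTop_of_one_lt (r := 2) (by norm_num)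
    ).eventually (eventually_sums_of_tendsto_average hμ ht))
  filter_upwards [eventually_ge_atTop ((2 : ℝ) ^ (H + J))] with R hR M hM
  have hR1 : (1 : ℝ) ≤ R := (one_le_pow₀ one_le_two).trans hR
  -- Choose N with 2^N ≤ R < 2^(N+1); the block [0, 2^N) alone will supply the unmatched points.
  obtain ⟨N, hN1, hN2⟩ := exists_nat_pow_near hR1 (one_lt_two)
  have hHJ : H + J ≤ N := by
    have := (pow_lt_pow_iff_right₀ (one_lt_two (α := ℝ))).1 (hR.trans_lt hN2)
    omega
  obtain ⟨j, rfl⟩ := Nat.exists_eq_add_of_le (show H ≤ N by omega)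
  have hcell : ∀ (n : ℕ) (i : ℕ), cell n (x i) = 0 ↔ x i < 2 ^ n := fun n i => by
    rw [cell_eq_iff_mem_Ico]
    simp [hx i]
  have hblock : ∀ (j k : ℕ), state x b M ((H + j : ℕ) : ℤ) k = merge^[j] t k := fun j k => by
    have h1 := congrFun (merge_state hx hfin hM H j) k
    push_cast
    rw [h1]
    exact merge_iterate_congr j k fun i _ _ => hstate M hM i
  have hlow : ∀ j, J ≤ j → (2 : ℝ) ^ j / 2 ≤ state x b M ((H + j : ℕ) : ℤ) 0 ∧
      0 < state x b M ((H + j : ℕ) : ℤ) 1 := fun j hj => by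
    obtain ⟨h1, h2⟩ := hJ j hj
    have h3 := sum_le_merge_iterate t j 0
    have h4 := sum_le_merge_iterate t j 1
    rw [← hblock] at h3 h4
    rw [zero_mul, zero_add, one_mul] at h3
    rw [one_mul] at h4
    push_cast at h1
    constructor
    · refine h1.trans ?_
      rw [← Nat.Ico_zero_eq_range]
      exact_mod_cast h3
    · have h5 : 0 < ∑ i ∈ Finset.Ico (2 ^ j) (2 * 2 ^ j), t i := by exact_mod_cast h2
      exact h5.trans_le h4
  have hfinite : {n ∈ unmatchedBlue b M | x n ∈ Icc 0 R}.Finite := by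
    refine (hfin ((H + j + 1 : ℕ) : ℤ) 0).subset fun i hi => ?_
    exact (hcell _ i).2 (hi.2.2.trans_lt hN2)
  refine ⟨hfinite, ?_⟩
  have hj := hlow j (by omega)
  have hpos : 0 < state x b M ((H + j : ℕ) : ℤ) 0 := by
    have : (0 : ℝ) < state x b M ((H + j : ℕ) : ℤ) 0 := lt_of_lt_of_le (by positivity) hj.1
    exact_mod_cast this
  have hunm := leftover_subset_unmatchedBlue hx hfin hM ((H + j : ℕ) : ℤ) hpos fun n hn => by
    obtain ⟨m, rfl⟩ := Int.eq_ofNat_of_zero_le (show 0 ≤ n by omega)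
    obtain ⟨i, rfl⟩ := Nat.exists_eq_add_of_le (show H ≤ m by omega)
    exact (hlow i (by omega)).2.le
  have hsub : leftover x M ((H + j : ℕ) : ℤ) 0 ⊆ {n ∈ unmatchedBlue b M | x n ∈ Icc 0 R} :=
    fun i hi => ⟨hunm hi, hx i, (((hcell _ i).1 hi.1).le).trans hN1⟩
  have hcard : state x b M ((H + j : ℕ) : ℤ) 0 = (leftover x M ((H + j : ℕ) : ℤ) 0).ncard := by
    rcases state_cases hx hfin hM ((H + j : ℕ) : ℤ) 0 with ⟨r, -, -, h⟩ | ⟨-, h⟩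
    · omega
    · exact h
  have h1 := hj.1
  rw [hcard] at h1
  have h2 : ((leftover x M ((H + j : ℕ) : ℤ) 0).ncard : ℝ) ≤
      {n ∈ unmatchedBlue b M | x n ∈ Icc 0 R}.ncard := by
    exact_mod_cast ncard_le_ncard hsub hfinite
  -- As R < 2^(H+j+1), half of 2^j is at least R / 2^(H+2); this fixes the constant.
  have h3 : 1 / 2 ^ (H + 2) * R ≤ (2 : ℝ) ^ j / 2 := by
    rw [one_div, inv_mul_le_iff₀ (by positivity)]
    refine hN2.le.trans_eq ?_
    ring
  push_cast at h1
  exact h3.trans (h1.trans h2)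

theorem infinite_of_eventually_le_ncard {A : Set ℕ} {x : ℕ → ℝ} {c : ℝ} (hc : 0 < c)
    (h : ∀ᶠ R : ℝ in atTop, c * R ≤ ({n ∈ A | x n ∈ Icc 0 R}.ncard : ℝ)) : A.Infinite := by
  intro hA
  obtain ⟨R, hR1, hR2⟩ := (h.and ((tendsto_id.const_mul_atTop hc).eventually
    (eventually_gt_atTop (A.ncard : ℝ)))).exists
  have h1 : ({n ∈ A | x n ∈ Icc 0 R}.ncard : ℝ) ≤ A.ncard := by
    exact_mod_cast ncard_le_ncard (sep_subset _ _) hA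
  simp only [id] at hR2
  linarith

end

end HierMatching

open HierMatching in
theorem theorem3 (lam p : ℝ) (hlam : 0 < lam) (hp0 : 0 < p) (hp1 : p < 1) :
    ∃ c : ℝ, 0 < c ∧
      ∀ (Ω : Type*) [MeasurableSpace Ω] (P : Measure Ω) [IsProbabilityMeasure P]
        (X : ℕ → Ω → ℝ) (blue : ℕ → Ω → Bool),
        HierMatching.IsColouredPoissonProcess P lam p X blue →
        (∀ᵐ ω ∂P,
          (HierMatching.stableMatchings (fun n => X n ω) (fun n => blue n ω)).Infinite ∧
          ∀ M ∈ HierMatching.stableMatchings (fun n => X n ω) (fun n => blue n ω),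
            (HierMatching.unmatchedBlue (fun n => blue n ω) M).Infinite) ∧
        (∀ᵐ ω ∂P, ∀ᶠ R : ℝ in atTop,
          ∀ M ∈ HierMatching.stableMatchings (fun n => X n ω) (fun n => blue n ω),
            {n ∈ HierMatching.unmatchedBlue (fun n => blue n ω) M | X n ω ∈ Icc 0 R}.Finite ∧
            c * R ≤ ({n ∈ HierMatching.unmatchedBlue (fun n => blue n ω) M |
              X n ω ∈ Icc 0 R}.ncard : ℝ)) := by
  -- The level depends on `lam` and `p` only, so the constant is chosen before the probability
  -- space.
  obtain ⟨H, hH⟩ := exists_level_one_le_integral (unitBlueProb_pos hlam hp0 hp1)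
  have hc : (0 : ℝ) < 1 / 2 ^ (H + 2) := by positivity
  refine ⟨1 / 2 ^ (H + 2), hc, fun Ω _ P _ X blue h => ?_⟩
  obtain ⟨S, hS, hstate, hS1, hint, hbound⟩ := h.exists_state_process hp0
  have hmean := hH hS hS1 hint hbound
  have hdens : ∀ᵐ ω ∂P, ∀ᶠ R : ℝ in atTop,
      ∀ M ∈ stableMatchings (fun n => X n ω) (fun n => blue n ω),
        {n ∈ unmatchedBlue (fun n => blue n ω) M | X n ω ∈ Icc 0 R}.Finite ∧
        1 / 2 ^ (H + 2) * R ≤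
          ({n ∈ unmatchedBlue (fun n => blue n ω) M | X n ω ∈ Icc 0 R}.ncard : ℝ) := by
    have hiid : IsIID P (fun k ω => ((mergeProcess^[H] S k ω : ℤ) : ℝ)) :=
      (hS.mergeProcess_iterate H).comp (measurable_of_countable (fun a : ℤ => (a : ℝ)))
    filter_upwards [h.poisson.nonneg, h.poisson.ae_finite_cell, hstate,
      hiid.tendsto_average (hS.integrable_mergeProcess_iterate hint H)] with ω h0 hfin hst hlim
    refine eventually_le_ncard_unmatchedBlue h0 hfin hmean (fun M hM k => ?_) hlim
    have h1 := congrFun (merge_state h0 hfin hM 0 H) k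
    rw [zero_add] at h1
    rw [h1, mergeProcess_iterate]
    exact merge_iterate_congr H k fun i _ _ => hst M hM i
  refine ⟨?_, hdens⟩
  filter_upwards [h.poisson.nonneg, h.poisson.injective, h.poisson.ae_finite_cell, hdens,
    h.ae_infinite_gadgets hlam hp0 hp1] with ω h0 hinj hfin hd hg
  refine ⟨infinite_stableMatchings h0 hinj (exists_mem_stableMatchings h0 hfin _) hg,
    fun M hM => infinite_of_eventually_le_ncard (x := fun n => X n ω) hc ?_⟩
  filter_upwards [hd] with R hR
  exact (hR M hM).2
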